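/- Let $\mathbb K\in\{\mathbb R,\mathbb C,\mathbb H\}$, $d=\dim_{\mathbb R}\mathbb K$, let $1\le p\le q$ and $n+1=p+q$. Let $G=\mathrm{SL}(n+1,\mathbb K)$ (for $\mathbb K=\mathbb H$: the matrices whose determinant as an $\mathbb R$-linear map is $1$), $K=\{x\in G: x^*=x^{-1}\}$ with its normalized Haar measure $dk$, and write matrices in blocks of sizes $p,q$. Put $H_o=\mathrm{diag}\big(\tfrac{q}{n+1}I_p,-\tfrac{p}{n+1}I_q\big)$, $A=\exp(\mathbb R H_o)$, $M=\{\mathrm{diag}(a,b)\in G: |\det_{\mathbb R} a|=1\}$, $N=\{\begin{pmatrix} I_p&X\\0&I_q\end{pmatrix}\}$, $\overline N=\{\begin{pmatrix} I_p&0\\Y&I_q\end{pmatrix}\}$, and let $P=MAN$ be the group of block upper triangular matrices in $G$. For $z\in\mathbb C$ put $\exp(tH_o)^z:=e^{z t pq/(n+1)}$. For $x\in\overline N P$ (an open dense subset of $G$ that contains almost every element of $K$) let $\alpha_P(x)\in A$ be the $A$-component of $x$ in $\overline N MAN$; for $x\in G=KMAN$ let $a_P(x)\in A$ be the $A$-component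 of $x$. Let $\rho=d(n+1)/2$, and normalize the Haar measure of $\overline N$ by $\int_{\overline N}a_P(\bar n)^{-2\rho}\,d\bar n=1$. For functions $f$ on $\mathcal B=G/P$ with base point $b_o=eP$ and for $k\in K$ let $$J(\lambda)f(k\cdot b_o)=\int_{\overline N}a_P(\bar n)^{-\lambda-\rho}f(k\bar n\cdot b_o)\,d\bar n .$$ For $z\in\mathbb C$ let $\Gamma_{p,d}(z)=\prod_{j=1}^p\Gamma\big(z-\tfrac d2(j-1)\big)$. Then for every $\lambda\in\mathbb C$ with $\operatorname{Re}\lambda>\rho-d$ the integral $c_P(\lambda):=\int_K\alpha_P(k)^{\lambda-\rho}\,dk$ and the integral $\int_{\overline N}a_P(\bar n)^{-\lambda-\rho}\,d\bar n$ that defines $J(\lambda)1$ converge absolutely, $J(\lambda)$ acts on the constant functions as multiplication by $c_P(\lambda)$ (in particular $J(\lambda)1=c_P(\lambda)$), and $$c_P(\lambda)=\frac{\Gamma_{p,d}\left(d(n+1)/2\right)}{\Gamma_{p,d}\left(dp/2\right)}\,\frac{\Gamma_{p,d}\left(\tfrac12(\lambda-\rho+dp)\right)}{\Gamma_{p,d}\left(\tfrac12(\lambda+\rho)\right)}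 .$$ The right-hand side is meromorphic on $\mathbb C$, and every meromorphic function on $\mathbb C$ that agrees with $c_P$ on some right half-plane equals it off a closed discrete set; so the formula holds for the meromorphic continuation of $c_P$ to $\mathbb C$. -/

import Mathlib

open MeasureTheory Matrix
open scoped Quaternion

noncomputable section
namespace CosLambda

/-! ### The scalars `𝕂 = ℝ, ℂ, ℍ` -/

/-- The three possible (skew) fields of scalars. -/
inductive ScalarField : Type
  | real
  | complex
  | quaternion

/-- The underlying (skew) field `ℝ`, `ℂ` or `ℍ`. -/
def ScalarField.Carrier : ScalarField → Type
  | .real => ℝ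
  | .complex => ℂ
  | .quaternion => ℍ[ℝ]

instance : CoeSort ScalarField Type := ⟨ScalarField.Carrier⟩

instance (F : ScalarField) : NormedDivisionRing F :=
  match F with
  | .real => inferInstanceAs (NormedDivisionRing ℝ)
  | .complex => inferInstanceAs (NormedDivisionRing ℂ)
  | .quaternion => inferInstanceAs (NormedDivisionRing ℍ[ℝ])

instance (F : ScalarField) : NormedAlgebra ℝ F :=
  match F with
  | .real => inferInstanceAs (NormedAlgebra ℝ ℝ)
  | .complex => inferInstanceAs (NormedAlgebra ℝ ℂ)
  | .quaternion => inferInstanceAs (NormedAlgebra ℝ ℍ[ℝ])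

/-- `star` is the canonical conjugation of `𝕂`. -/
instance (F : ScalarField) : StarRing F :=
  match F with
  | .real => inferInstanceAs (StarRing ℝ)
  | .complex => inferInstanceAs (StarRing ℂ)
  | .quaternion => inferInstanceAs (StarRing ℍ[ℝ])

instance (F : ScalarField) : FiniteDimensional ℝ F :=
  match F with
  | .real => inferInstanceAs (FiniteDimensional ℝ ℝ)
  | .complex => inferInstanceAs (FiniteDimensional ℝ ℂ)
  | .quaternion => inferInstanceAs (FiniteDimensional ℝ ℍ[ℝ])

theorem star_mul_self_eq (F : ScalarField) (a : F) :
    star a * a = algebraMap ℝ F (‖a‖ ^ 2) := by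
  have hR : ∀ a : ℝ, star a * a = algebraMap ℝ ℝ (‖a‖ ^ 2) := fun a => by simp [sq]
  have hC : ∀ a : ℂ, star a * a = algebraMap ℝ ℂ (‖a‖ ^ 2) := fun a => by
    simpa using Complex.conj_mul' a
  have hH : ∀ a : ℍ[ℝ], star a * a = algebraMap ℝ ℍ[ℝ] (‖a‖ ^ 2) := fun a => by
    rw [Quaternion.star_mul_self, Quaternion.normSq_eq_norm_mul_self, sq]
    rfl
  match F, a with
  | .real, a => exact hR a
  | .complex, a => exact hC a
  | .quaternion, a => exact hH a

instance (F : ScalarField) : ProperSpace F := FiniteDimensional.proper ℝ F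

instance (F : ScalarField) : NormedStarGroup F where
  norm_star_le a := by
    have h : ‖star a‖ * ‖a‖ = ‖a‖ * ‖a‖ := by
      rw [← norm_mul, star_mul_self_eq, norm_algebraMap', norm_pow, norm_norm, sq]
    rcases eq_or_ne a 0 with rfl | ha
    · simp
    · exact (mul_right_cancel₀ (norm_ne_zero_iff.2 ha) h).le

instance (F : ScalarField) : MeasurableSpace F := borel F

instance (F : ScalarField) : BorelSpace F := ⟨rfl⟩

/-- `d = dim_ℝ 𝕂`, that is `1`, `2`, `4` for `ℝ`, `ℂ`, `ℍ`. -/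
def ScalarField.d (F : ScalarField) : ℕ := Module.finrank ℝ F

/-! ### Determinants and the group `SL(m, 𝕂)` -/

section Determinant

variable {F : ScalarField} {ι : Type} [Fintype ι] [DecidableEq ι]

/-- A square matrix over `𝕂` acting on column vectors, as an `ℝ`-linear map. -/
def realAction : Matrix ι ι F →* Module.End ℝ (ι → F) where
  toFun x :=
    { toFun := fun v => x *ᵥ v
      map_add' := fun v w => Matrix.mulVec_add x v w
      map_smul' := fun c v => Matrix.mulVec_smul x c v }
  map_one' := LinearMap.ext fun v => by simp
  map_mul' x y := LinearMap.ext fun v => by simp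

/-- `det_ℝ x`: the determinant of `x` as an `ℝ`-linear map of `𝕂^m`. -/
def realDet : Matrix ι ι F →* ℝ := LinearMap.det.comp realAction

end Determinant

/-- `SL(m, 𝕂)`: for `ℝ` and `ℂ` the matrices of determinant one. For `ℍ` the (Dieudonné)
determinant is the positive real number whose fourth power is `det_ℝ`, so that it is one exactly
if `det_ℝ` is. -/
def specialLinear (F : ScalarField) (ι : Type) [Fintype ι] [DecidableEq ι] :
    Subgroup (Matrix ι ι F)ˣ :=
  match F with
  | .real => ((Matrix.detMonoidHom : Matrix ι ι ℝ →* ℝ).comp (Units.coeHom _)).ker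
  | .complex => ((Matrix.detMonoidHom : Matrix ι ι ℂ →* ℂ).comp (Units.coeHom _)).ker
  | .quaternion => (realDet.comp (Units.coeHom _)).ker

theorem commutator_mem_ker {G M : Type} [Group G] [CommMonoid M] (f : G →* M) (g h : G) :
    g * h * g⁻¹ * h⁻¹ ∈ f.ker := by
  rw [MonoidHom.mem_ker, map_mul, map_mul, map_mul, mul_right_comm (f g), ← map_mul f g g⁻¹,
    mul_inv_cancel, map_one, one_mul, ← map_mul, mul_inv_cancel, map_one]

theorem commutator_mem_specialLinear (F : ScalarField) {ι : Type} [Fintype ι] [DecidableEq ι]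
    (g h : (Matrix ι ι F)ˣ) : g * h * g⁻¹ * h⁻¹ ∈ specialLinear F ι := by
  match F, g, h with
  | .real, g, h => exact commutator_mem_ker _ g h
  | .complex, g, h => exact commutator_mem_ker _ g h
  | .quaternion, g, h => exact commutator_mem_ker _ g h

theorem isClosed_specialLinear (F : ScalarField) {ι : Type} [Fintype ι] [DecidableEq ι] :
    ∃ S : Set (Matrix ι ι F), IsClosed S ∧ ∀ x, x ∈ specialLinear F ι ↔ (x : Matrix ι ι F) ∈ S := by
  have hR : IsClosed {x : Matrix ι ι ℝ | x.det = 1} :=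
    isClosed_eq (Continuous.matrix_det continuous_id) continuous_const
  have hC : IsClosed {x : Matrix ι ι ℂ | x.det = 1} :=
    isClosed_eq (Continuous.matrix_det continuous_id) continuous_const
  match F with
  | .real => exact ⟨{x : Matrix ι ι ℝ | x.det = 1}, hR, fun x => Iff.rfl⟩
  | .complex => exact ⟨{x : Matrix ι ι ℂ | x.det = 1}, hC, fun x => Iff.rfl⟩
  | .quaternion =>
    refine ⟨{x | realDet x = 1}, isClosed_eq ?_ continuous_const, fun x => Iff.rfl⟩
    let T : Matrix ι ι ScalarField.quaternion →ₗ[ℝ]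
        ((ι → ScalarField.quaternion) →L[ℝ] (ι → ScalarField.quaternion)) :=
      { toFun := fun x => LinearMap.toContinuousLinearMap (realAction x)
        map_add' := fun x y => by
          ext1 v
          exact Matrix.add_mulVec x y v
        map_smul' := fun c x => by
          ext1 v
          exact Matrix.smul_mulVec c x v }
    have hT : Continuous T := T.continuous_of_finiteDimensional
    exact ContinuousLinearMap.continuous_det.comp hT

/-! ### The group `G = SL(n+1, 𝕂)` in blocks, `n + 1 = p + q` -/

section Groups

variable (F : ScalarField) (p q : ℕ)

/-- The `(p+q) × (p+q)` matrices over `𝕂`, in blocks. -/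
abbrev Mat : Type := Matrix (Fin p ⊕ Fin q) (Fin p ⊕ Fin q) F

/-- `G = SL(p + q, 𝕂)`. -/
abbrev G : Type := ↥(specialLinear F (Fin p ⊕ Fin q))

/-- The underlying matrix of an element of `G`. -/
def G.mat {F : ScalarField} {p q : ℕ} (x : G F p q) : Mat F p q := ((x : (Mat F p q)ˣ) : Mat F p q)

/-- `K = SU(p + q, 𝕂) = {x ∈ G | x* = x⁻¹}`. -/
def K : Subgroup (G F p q) where
  carrier := {x | star x.mat * x.mat = 1}
  one_mem' := by simp [G.mat]
  mul_mem' := by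
    intro x y hx hy
    simp only [Set.mem_ofPred_eq, G.mat, Subgroup.coe_mul, Units.val_mul, star_mul] at *
    rw [mul_assoc, ← mul_assoc (star (x : (Mat F p q)ˣ).val), hx, one_mul, hy]
  inv_mem' := by
    intro x hx
    simp only [Set.mem_ofPred_eq, G.mat, Subgroup.coe_inv] at *
    rw [← Units.eq_inv_of_mul_eq_one_right hx, star_star, Units.eq_inv_of_mul_eq_one_right hx]
    exact Units.mul_inv _

/-- The maximal parabolic subgroup `P` of block upper triangular matrices in `G`. -/
def P : Subgroup (G F p q) where
  carrier := {x | ∃ (a : (Matrix (Fin p) (Fin p) F)ˣ) (b : (Matrix (Fin q) (Fin q) F)ˣ)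
    (X : Matrix (Fin p) (Fin q) F), x.mat = fromBlocks a.val X 0 b.val}
  one_mem' := ⟨1, 1, 0, by simp [G.mat]⟩
  mul_mem' := by
    rintro x y ⟨a, b, X, hx⟩ ⟨a', b', X', hy⟩
    refine ⟨a * a', b * b', a.val * X' + X * b'.val, ?_⟩
    have : (x * y).mat = x.mat * y.mat := rfl
    rw [this, hx, hy, fromBlocks_multiply]
    simp
  inv_mem' := by
    rintro x ⟨a, b, X, hx⟩
    refine ⟨a⁻¹, b⁻¹, -(a⁻¹.val * X * b⁻¹.val), ?_⟩
    change ((x : (Mat F p q)ˣ)⁻¹).val = _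
    symm
    apply Units.eq_inv_of_mul_eq_one_right
    change _ * x.mat = 1
    rw [hx, fromBlocks_multiply]
    simp [Matrix.mul_assoc]

/-- The Grassmann manifold `𝓑 = Gr_p(𝕂) = G / P`. -/
abbrev B : Type := G F p q ⧸ P F p q

variable {F p q}

/-- `n(X)`, a general element of the group `N`. -/
def nMat (X : Matrix (Fin p) (Fin q) F) : Mat F p q := fromBlocks 1 X 0 1

/-- `n̄(Y)`, a general element of the group `N̄`. -/
def nbarMat (Y : Matrix (Fin q) (Fin p) F) : Mat F p q := fromBlocks 1 0 Y 1

theorem nbarMat_mul (Y Z : Matrix (Fin q) (Fin p) F) :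
    nbarMat Y * nbarMat Z = nbarMat (Y + Z) := by
  simp [nbarMat, fromBlocks_multiply]

theorem nbarMat_zero : nbarMat (0 : Matrix (Fin q) (Fin p) F) = 1 := by
  simp [nbarMat]

/-- `n̄(Y)` as an invertible matrix. -/
def nbarUnit (Y : Matrix (Fin q) (Fin p) F) : (Mat F p q)ˣ where
  val := nbarMat Y
  inv := nbarMat (-Y)
  val_inv := by rw [nbarMat_mul, add_neg_cancel, nbarMat_zero]
  inv_val := by rw [nbarMat_mul, neg_add_cancel, nbarMat_zero]

theorem nbarUnit_mem (Y : Matrix (Fin q) (Fin p) F) :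
    nbarUnit Y ∈ specialLinear F (Fin p ⊕ Fin q) := by
  let g : (Mat F p q)ˣ :=
    { val := fromBlocks 1 0 0 ((2 : ℝ) • 1)
      inv := fromBlocks 1 0 0 ((2⁻¹ : ℝ) • 1)
      val_inv := by simp [fromBlocks_multiply]
      inv_val := by simp [fromBlocks_multiply] }
  have h : nbarUnit Y = g * nbarUnit Y * g⁻¹ * (nbarUnit Y)⁻¹ := by
    rw [eq_mul_inv_iff_mul_eq, eq_mul_inv_iff_mul_eq]
    ext1
    change nbarMat Y * nbarMat Y * fromBlocks 1 0 0 ((2 : ℝ) • 1)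
      = fromBlocks 1 0 0 ((2 : ℝ) • 1) * nbarMat Y
    simp [nbarMat, fromBlocks_multiply, ← two_smul ℝ]
  rw [h]
  exact commutator_mem_specialLinear F _ _

/-- `n̄(Y)` as an element of `G`. -/
def nbar (Y : Matrix (Fin q) (Fin p) F) : G F p q := ⟨nbarUnit Y, nbarUnit_mem Y⟩

variable (F p q) in
/-- `H_o = diag((q/(n+1)) I_p, -(p/(n+1)) I_q)` with `n + 1 = p + q`; `𝔞 = ℝ H_o`. -/
def Ho : Mat F p q :=
  fromBlocks (((q : ℝ) / ((p : ℝ) + q)) • 1) 0 0 ((-((p : ℝ) / ((p : ℝ) + q))) • 1)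

variable (F p q) in
/-- `exp (t H_o)`, a general element of the group `A = exp 𝔞`. -/
def aMat (t : ℝ) : Mat F p q := NormedSpace.exp (t • Ho F p q)

variable (F p q) in
theorem aMat_eq (t : ℝ) : aMat F p q t =
    fromBlocks (Real.exp (t * ((q : ℝ) / ((p : ℝ) + q))) • 1) 0 0
      (Real.exp (t * (-((p : ℝ) / ((p : ℝ) + q)))) • 1) := by
  have hd : ∀ r s : ℝ, (fromBlocks (r • 1) 0 0 (s • 1) : Mat F p q) =
      diagonal (Sum.elim (fun _ => algebraMap ℝ F r) (fun _ => algebraMap ℝ F s)) := by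
    intro r s
    rw [← fromBlocks_diagonal, Algebra.algebraMap_eq_smul_one, Algebra.algebraMap_eq_smul_one]
    congr 1 <;> ext i j <;> by_cases h : i = j <;> simp [h]
  have he : ∀ r : ℝ, NormedSpace.exp (algebraMap ℝ F r) = algebraMap ℝ F (Real.exp r) := by
    intro r
    rw [Real.exp_eq_exp_ℝ, NormedSpace.algebraMap_exp_comm]
  let : NormedAlgebra ℚ F := NormedAlgebra.restrictScalars ℚ ℝ F
  rw [aMat, Ho, fromBlocks_smul, smul_smul, smul_smul, smul_zero, smul_zero, hd, hd,
    Matrix.exp_diagonal]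
  congr 1
  funext i
  rw [Pi.coe_exp]
  cases i
  · exact he _
  · exact he _

variable (F p q) in
/-- The group `M`: block diagonal `m(a, b) ∈ G` with `|det a| = 1` (hence also `|det b| = 1`).
Recall `|det_ℝ a| = |det a| ^ d`. -/
def M : Set (G F p q) :=
  {x | ∃ (a : Matrix (Fin p) (Fin p) F) (b : Matrix (Fin q) (Fin q) F),
    x.mat = fromBlocks a 0 0 b ∧ |realDet a| = 1}

/-- `x = n̄ m exp(t H_o) n` for some `n̄ ∈ N̄`, `m ∈ M`, `n ∈ N`, i.e. `x ∈ N̄ P` and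
`α_P(x) = exp(t H_o)`. -/
def IsAlpha (x : G F p q) (t : ℝ) : Prop :=
  ∃ (Y : Matrix (Fin q) (Fin p) F) (m : G F p q) (X : Matrix (Fin p) (Fin q) F),
    m ∈ M F p q ∧ x.mat = nbarMat Y * m.mat * aMat F p q t * nMat X

/-- `x = k m exp(t H_o) n` for some `k ∈ K`, `m ∈ M`, `n ∈ N`, i.e. `a_P(x) = exp(t H_o)`. -/
def IsIwasawa (x : G F p q) (t : ℝ) : Prop :=
  ∃ (k m : G F p q) (X : Matrix (Fin p) (Fin q) F),
    k ∈ K F p q ∧ m ∈ M F p q ∧ x.mat = k.mat * m.mat * aMat F p q t * nMat X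

variable (p q) in
/-- `exp(t H_o) ^ z`. The number `z ∈ ℂ` stands for the element `z (pq/(n+1)) α` of `𝔞_ℂ^*`,
where `α(H_o) = 1`. -/
def aPow (t : ℝ) (z : ℂ) : ℂ := Complex.exp (z * ((p : ℂ) * q / ((p : ℂ) + q)) * t)

open Classical in
/-- `α_P(x) ^ z` for `x ∈ N̄ P` (and `0` outside the open dense set `N̄ P`, where `α_P` is
not defined). -/
def alphaPow (x : G F p q) (z : ℂ) : ℂ :=
  if h : ∃ t, IsAlpha x t then aPow p q h.choose z else 0

open Classical in
/-- `a_P(x) ^ z` for `x ∈ G = K M A N`. -/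
def iwasawaPow (x : G F p q) (z : ℂ) : ℂ :=
  if h : ∃ t, IsIwasawa x t then aPow p q h.choose z else 0

end Groups

/-! ### Invariant measures -/

section Measures

variable (F : ScalarField) (p q : ℕ)

instance : MeasurableSpace (K F p q) := borel _

instance : BorelSpace (K F p q) := ⟨rfl⟩

instance : CompactSpace (K F p q) := by
  obtain ⟨S, hS, hSG⟩ := isClosed_specialLinear F (ι := Fin p ⊕ Fin q)
  let C : Set (Mat F p q) := {x | star x * x = 1 ∧ x * star x = 1 ∧ x ∈ S}
  have hcl : IsClosed C := by
    have h1 : IsClosed {x : Mat F p q | star x * x = 1} :=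
      isClosed_eq (continuous_star.mul continuous_id) continuous_const
    have h2 : IsClosed {x : Mat F p q | x * star x = 1} :=
      isClosed_eq (continuous_id.mul continuous_star) continuous_const
    exact h1.inter (h2.inter hS)
  have hsub : C ⊆ Set.pi Set.univ
      (fun _ => Set.pi Set.univ (fun _ => Metric.closedBall (0 : F) 1)) := by
    rintro x ⟨hx, -, -⟩ i - j -
    rw [mem_closedBall_zero_iff]
    have h := congrFun (congrFun hx j) j
    rw [Matrix.mul_apply, Matrix.one_apply_eq] at h
    simp only [Matrix.star_apply, star_mul_self_eq, ← map_sum] at h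
    rw [← map_one (algebraMap ℝ F)] at h
    have h' := (algebraMap ℝ F).injective h
    have h'' : ‖x i j‖ ^ 2 ≤ 1 := by
      rw [← h']
      exact Finset.single_le_sum (f := fun k => ‖x k j‖ ^ 2) (fun _ _ => by positivity)
        (Finset.mem_univ i)
    nlinarith [norm_nonneg (x i j)]
  have hC : IsCompact C := by
    refine IsCompact.of_isClosed_subset ?_ hcl hsub
    exact isCompact_univ_pi fun _ => isCompact_univ_pi fun _ => isCompact_closedBall _ _
  have : CompactSpace C := isCompact_iff_compactSpace.1 hC
  let u : C → (Mat F p q)ˣ := fun x => ⟨x.1, star x.1, x.2.2.1, x.2.1⟩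
  have hu : Continuous u := Units.continuous_iff.2
    ⟨continuous_subtype_val, continuous_star.comp continuous_subtype_val⟩
  let ψ : C → K F p q := fun x => ⟨⟨u x, (hSG _).2 x.2.2.2⟩, x.2.1⟩
  have hψ : Continuous ψ := (hu.subtype_mk _).subtype_mk _
  refine Function.Surjective.compactSpace (f := ψ) hψ ?_
  rintro ⟨⟨x, hx⟩, hk⟩
  have hk' : star x.val * x.val = 1 := hk
  have hinv : star x.val = x⁻¹.val := Units.eq_inv_of_mul_eq_one_right hk'
  exact ⟨⟨x.val, hk', by rw [hinv]; exact x.mul_inv, (hSG x).1 hx⟩,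
    Subtype.ext (Subtype.ext (Units.ext rfl))⟩

/-- `dk`: the Haar measure of the compact group `K` of total mass one. -/
def haarK : Measure (K F p q) := Measure.haarMeasure ⊤

/-- `ρ = d(n+1)/2`, the number that corresponds to half the sum of the positive roots,
`(dpq/2) α`. -/
def rho : ℝ := (F.d : ℝ) * ((p : ℝ) + q) / 2

/-- `d n̄`: the Haar measure of `N̄`, transported to `M_{q×p}(𝕂)` by `n̄(Y) ↔ Y`, normalized by
`∫ a_P(n̄) ^ (-2ρ) d n̄ = 1`. -/
def haarNbar : Measure (Fin q → Fin p → F) :=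
  (∫⁻ Y : Fin q → Fin p → F, ‖iwasawaPow (nbar (Matrix.of Y)) (-(2 * rho F p q))‖ₑ
    ∂Measure.addHaar)⁻¹ • Measure.addHaar

end Measures

/-! ### The function `c_P` and the intertwining operator `J(λ)` -/

section Main

variable (F : ScalarField) (p q : ℕ)

/-- `∫_K α_P(k) ^ (λ - ρ) dk`. -/
def cP (lam : ℂ) : ℂ := ∫ k : K F p q, alphaPow (k : G F p q) (lam - rho F p q) ∂haarK F p q

/-- The value at `k · b_o` of the standard intertwining operator,
`J(λ) f (k · b_o) = ∫_{N̄} a_P(n̄) ^ (-λ - ρ) f(k n̄ · b_o) d n̄`. -/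
def J (lam : ℂ) (f : B F p q → ℂ) (k : K F p q) : ℂ :=
  ∫ Y : Fin q → Fin p → F,
    iwasawaPow (nbar (Matrix.of Y)) (-lam - rho F p q) *
      f (QuotientGroup.mk ((k : G F p q) * nbar (Matrix.of Y))) ∂haarNbar F p q

/-- The Siegel (Gindikin) Gamma function `Γ_{p,d}(z) = ∏_{j=1}^p Γ(z_j - (d/2)(j-1))`. -/
def siegelGamma (p d : ℕ) (z : Fin p → ℂ) : ℂ :=
  ∏ j : Fin p, Complex.Gamma (z j - (d : ℂ) / 2 * (j : ℕ))

/-- The quotient of Gamma functions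
`Γ_{p,d}(d(n+1)/2) Γ_{p,d}((λ-ρ+dp)/2) / (Γ_{p,d}(dp/2) Γ_{p,d}((λ+ρ)/2))`; a number stands for
the constant vector. -/
def gammaQuotient (lam : ℂ) : ℂ :=
  siegelGamma p F.d (fun _ => (F.d : ℂ) * ((p : ℂ) + q) / 2) /
      siegelGamma p F.d (fun _ => (F.d : ℂ) * p / 2) *
    (siegelGamma p F.d (fun _ => (lam - rho F p q + F.d * p) / 2) /
      siegelGamma p F.d (fun _ => (lam + rho F p q) / 2))

end Main

end CosLambda
end

/-!
Let `Z` be a Gaussian `(p+q) × p` matrix over `𝕂` with blocks `Z₁` and `Z₂`. In terms of the first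
`p` columns of a group element `x`, the number `α_P(x)` is `|det_ℝ|` of the upper block and `a_P(x)`
is the volume that the columns span, both up to a fixed power. Hence, by unitary invariance, for a
Haar distributed `k ∈ K` the quantity `α_P(k)` has the law of `|det Z₁| / vol Z`.

Substitute `Z₂ = Y Z₁`. The columns of `n̄(Y)` are an isometry times a square matrix `S` with
`|det S| = v(Y)`, the volume form of `a_P(n̄(Y))`, so with `W = S Z₁` one gets `vol Z = |det W|` and
`|det Z₁| = |det W| / v(Y)`. The Jacobian makes `Y`, with density `v(Y)^{-(p+q)}`, that is
`a_P(n̄)^{-2ρ}`, independent of `W`, with density `|det W|^q` times the Gaussian. Therefore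
`|det k₁₁|` has the law of `v(Y)⁻¹`, which is the identity `c_P(λ) = J(λ)1`, and the moments of
`|det Z₁|` are the products of those of `v(Y)⁻¹` and of `|det W|`. The value of `c_P` is thus a
quotient of moments of the determinant of a square Gaussian matrix, and these satisfy a recursion:
rotating the first row onto a coordinate axis splits off the radial moment of one Gaussian vector,
a single Gamma factor.
-/

noncomputable section
namespace CosLambda

/-! ### The real trace form and the real determinant -/

section Scalars

variable {F : ScalarField}

theorem star_algebraMap (r : ℝ) : star (algebraMap ℝ F r) = algebraMap ℝ F r := by
  have hR : ∀ r : ℝ, star (algebraMap ℝ ℝ r) = algebraMap ℝ ℝ r := fun r => by simp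
  have hC : ∀ r : ℝ, star (algebraMap ℝ ℂ r) = algebraMap ℝ ℂ r := fun r => by simp
  have hH : ∀ r : ℝ, star (algebraMap ℝ ℍ[ℝ] r) = algebraMap ℝ ℍ[ℝ] r := Quaternion.star_coe
  match F with
  | .real => exact hR r
  | .complex => exact hC r
  | .quaternion => exact hH r

instance : StarModule ℝ F where
  star_smul r a := by
    rw [Algebra.smul_def, star_mul, star_algebraMap, ← Algebra.commutes, ← Algebra.smul_def,
      star_trivial r]

theorem algebraMap_polarization (a : F) :
    algebraMap ℝ F (‖a + 1‖ ^ 2 - ‖a‖ ^ 2 - 1) = a + star a := by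
  rw [map_sub, map_sub, ← star_mul_self_eq F (a + 1), ← star_mul_self_eq, map_one, star_add,
    star_one]
  noncomm_ring

variable (F) in
/-- Twice the real part of an element of `𝕂`; the polarization of the norm makes sense
simultaneously for `ℝ`, `ℂ` and `ℍ`. -/
def traceForm : F →ₗ[ℝ] ℝ where
  toFun a := ‖a + 1‖ ^ 2 - ‖a‖ ^ 2 - 1
  map_add' a b := by
    apply (algebraMap ℝ F).injective
    rw [map_add, algebraMap_polarization, algebraMap_polarization, algebraMap_polarization,
      star_add]
    abel
  map_smul' r a := by
    apply (algebraMap ℝ F).injective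
    rw [RingHom.id_apply, smul_eq_mul, map_mul, algebraMap_polarization, algebraMap_polarization,
      star_smul, star_trivial, ← Algebra.smul_def, smul_add]

theorem traceForm_star_mul_self (a : F) : traceForm F (star a * a) = 2 * ‖a‖ ^ 2 := by
  apply (algebraMap ℝ F).injective
  refine (algebraMap_polarization _).trans ?_
  rw [star_mul, star_star, star_mul_self_eq, ← map_add, two_mul]

end Scalars

section Pairing

variable {F : ScalarField} {ι : Type} [Fintype ι]

/-- The real inner product on `𝕂^m`, up to a factor of two, as a map to the dual space. -/
def pairing (F : ScalarField) (ι : Type) [Fintype ι] : (ι → F) →ₗ[ℝ] Module.Dual ℝ (ι → F) :=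
  LinearMap.mk₂ ℝ (fun v w => ∑ i, traceForm F (star (v i) * w i))
    (fun v v' w => by simp [add_mul, Finset.sum_add_distrib])
    (fun r v w => by simp [Finset.mul_sum])
    (fun v w w' => by simp [mul_add, Finset.sum_add_distrib])
    (fun r v w => by simp [Finset.mul_sum])

theorem pairing_apply (v w : ι → F) :
    pairing F ι v w = ∑ i, traceForm F (star (v i) * w i) := rfl

theorem pairing_injective : Function.Injective (pairing F ι) := by
  rw [injective_iff_map_eq_zero]
  intro v hv
  have h : ∑ i, 2 * ‖v i‖ ^ 2 = 0 := by
    simpa [pairing_apply, traceForm_star_mul_self] using LinearMap.congr_fun hv v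
  rw [Finset.sum_eq_zero_iff_of_nonneg (fun i _ => by positivity)] at h
  funext i
  simpa using h i (Finset.mem_univ i)

theorem pairing_mulVec (x : Matrix ι ι F) (v w : ι → F) :
    pairing F ι (x *ᵥ v) w = pairing F ι v (star x *ᵥ w) := by
  simp only [pairing_apply, mulVec, dotProduct, star_sum, star_mul, Finset.sum_mul, Finset.mul_sum,
    map_sum, star_apply, mul_assoc]
  exact Finset.sum_comm

end Pairing

section RealDet

variable {F : ScalarField} {ι κ : Type} [Fintype ι] [DecidableEq ι] [Fintype κ] [DecidableEq κ]

@[simp]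
theorem realAction_apply (x : Matrix ι ι F) (v : ι → F) : realAction x v = x *ᵥ v := rfl

theorem realDet_apply (x : Matrix ι ι F) : realDet x = LinearMap.det (realAction x) := rfl

theorem realDet_ne_zero (x : (Matrix ι ι F)ˣ) : realDet x.val ≠ 0 :=
  (x.isUnit.map realDet).ne_zero

theorem isUnit_of_realDet_ne_zero {x : Matrix ι ι F} (h : realDet x ≠ 0) : IsUnit x := by
  have hunit : IsUnit (realAction x) := (realAction x).isUnit_iff_isUnit_det.2 h.isUnit
  have hsurj : Function.Surjective x.mulVec :=
    LinearMap.range_eq_top.1 ((LinearMap.isUnit_iff_range_eq_top _).1 hunit)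
  exact isUnit_iff_exists_inv.2 (mulVec_surjective_iff_exists_right_inverse.1 hsurj)

/-- `realDet` is the determinant over `ℝ`, and `x*` acts as the adjoint for the real inner
product. -/
theorem realDet_star (x : Matrix ι ι F) : realDet (star x) = realDet x := by
  let e : (ι → F) ≃ₗ[ℝ] Module.Dual ℝ (ι → F) :=
    LinearEquiv.ofInjectiveOfFinrankEq (pairing F ι) pairing_injective
      Subspace.dual_finrank_eq.symm
  rw [realDet_apply, realDet_apply, ← LinearMap.det_dualMap (realAction (star x)),
    ← LinearMap.det_conj (realAction x) e]
  congr 1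
  refine LinearMap.ext fun f => LinearMap.ext fun w => ?_
  obtain ⟨v, rfl⟩ := e.surjective f
  rw [LinearMap.comp_apply, LinearMap.comp_apply, LinearEquiv.coe_coe, LinearEquiv.coe_coe,
    e.symm_apply_apply]
  exact (pairing_mulVec x v w).symm

theorem abs_realDet_of_mem_unitary {U : Matrix ι ι F} (hU : U ∈ unitary (Matrix ι ι F)) :
    |realDet U| = 1 := by
  have h := congrArg realDet hU.1
  rw [map_mul, realDet_star, map_one] at h
  rcases mul_self_eq_one_iff.1 h with h | h <;> simp [h]

/-- Entrywise conjugation of vectors over `𝕂`; it exchanges the actions of matrices on columns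
and on rows. -/
def starVec (F : ScalarField) (ι : Type) : (ι → F) ≃ₗ[ℝ] (ι → F) where
  toFun v := star v
  invFun v := star v
  left_inv v := star_star v
  right_inv v := star_star v
  map_add' v w := star_add v w
  map_smul' r v := by simp

/-- Right multiplication by a square matrix on row vectors, as an `ℝ`-linear map. -/
def rowAction (x : Matrix ι ι F) : Module.End ℝ (ι → F) where
  toFun v := v ᵥ* x
  map_add' v w := Matrix.add_vecMul x v w
  map_smul' c v := Matrix.smul_vecMul c v x

theorem det_rowAction (x : Matrix ι ι F) : LinearMap.det (rowAction x) = realDet x := by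
  rw [← realDet_star, realDet_apply, ← LinearMap.det_conj (realAction (star x)) (starVec F ι)]
  congr 1
  refine LinearMap.ext fun v => ?_
  change v ᵥ* x = star (xᴴ *ᵥ star v)
  rw [star_mulVec, conjTranspose_conjTranspose, star_star]

theorem realDet_submatrix (e : κ ≃ ι) (x : Matrix ι ι F) :
    realDet (x.submatrix e e) = realDet x := by
  rw [realDet_apply, realDet_apply,
    ← LinearMap.det_conj (realAction x) (LinearEquiv.funCongrLeft ℝ F e)]
  congr 1
  refine LinearMap.ext fun v => ?_
  change x.submatrix e e *ᵥ v = (x *ᵥ (v ∘ e.symm)) ∘ e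
  rw [Matrix.submatrix_mulVec_equiv]

theorem realDet_smul_one (r : ℝ) :
    realDet (r • (1 : Matrix ι ι F)) = r ^ (F.d * Fintype.card ι) := by
  have haction : realAction (r • (1 : Matrix ι ι F)) = r • LinearMap.id :=
    LinearMap.ext fun v => by simp [Matrix.smul_mulVec]
  rw [realDet_apply, haction, LinearMap.det_smul, LinearMap.det_id, mul_one,
    Module.finrank_pi_fintype, Finset.sum_const, Finset.card_univ, smul_eq_mul, mul_comm,
    ScalarField.d]

theorem realDet_fromBlocks_diagonal (a : Matrix ι ι F) (b : Matrix κ κ F) :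
    realDet (fromBlocks a 0 0 b) = realDet a * realDet b := by
  let e := LinearEquiv.sumArrowLequivProdArrow ι κ ℝ F
  rw [realDet_apply, realDet_apply, realDet_apply, ← LinearMap.det_prodMap,
    ← LinearMap.det_conj _ e]
  congr 1
  apply LinearMap.ext
  rintro ⟨v, w⟩
  change e (fromBlocks a 0 0 b *ᵥ Sum.elim v w) = (a *ᵥ v, b *ᵥ w)
  rw [fromBlocks_mulVec]
  refine Prod.ext ?_ ?_ <;> funext i <;> simp [e, LinearEquiv.sumArrowLequivProdArrow]

/-- The block unipotent matrix with upper right block `X`, for blocks of arbitrary sizes. -/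
def unipotentUnit (X : Matrix ι κ F) : (Matrix (ι ⊕ κ) (ι ⊕ κ) F)ˣ where
  val := fromBlocks 1 X 0 1
  inv := fromBlocks 1 (-X) 0 1
  val_inv := by simp [fromBlocks_multiply]
  inv_val := by simp [fromBlocks_multiply]

/-- Conjugation by `diag(2, 1)` squares a block unipotent matrix. -/
theorem unipotentUnit_eq_commutator (X : Matrix ι κ F) :
    ∃ g, unipotentUnit X = g * unipotentUnit X * g⁻¹ * (unipotentUnit X)⁻¹ := by
  let g : (Matrix (ι ⊕ κ) (ι ⊕ κ) F)ˣ :=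
    { val := fromBlocks ((2 : ℝ) • 1) 0 0 1
      inv := fromBlocks ((2⁻¹ : ℝ) • 1) 0 0 1
      val_inv := by simp [fromBlocks_multiply]
      inv_val := by simp [fromBlocks_multiply] }
  refine ⟨g, ?_⟩
  rw [eq_mul_inv_iff_mul_eq, eq_mul_inv_iff_mul_eq]
  ext1
  simp [unipotentUnit, g, fromBlocks_multiply, ← two_smul ℝ]

theorem unipotentUnit_mem_specialLinear (X : Matrix ι κ F) :
    unipotentUnit X ∈ specialLinear F (ι ⊕ κ) := by
  obtain ⟨g, hg⟩ := unipotentUnit_eq_commutator X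
  exact hg ▸ commutator_mem_specialLinear F g (unipotentUnit X)

theorem realDet_unipotentUnit (X : Matrix ι κ F) : realDet (unipotentUnit X).val = 1 := by
  obtain ⟨g, hg⟩ := unipotentUnit_eq_commutator X
  rw [hg]
  exact commutator_mem_ker (realDet.comp (Units.coeHom _)) g (unipotentUnit X)

theorem realDet_fromBlocks (a : Matrix ι ι F) (X : Matrix ι κ F) (b : Matrix κ κ F) :
    realDet (fromBlocks a X 0 b) = realDet a * realDet b := by
  have h : fromBlocks a X 0 b =
      fromBlocks 1 0 0 b * (unipotentUnit X).val * fromBlocks a 0 0 1 := by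
    simp [unipotentUnit, fromBlocks_multiply]
  rw [h, map_mul, map_mul, realDet_unipotentUnit, realDet_fromBlocks_diagonal,
    realDet_fromBlocks_diagonal, map_one, map_one]
  ring

theorem continuous_realDet : Continuous (realDet : Matrix ι ι F → ℝ) := by
  let T : Matrix ι ι F →ₗ[ℝ] ((ι → F) →L[ℝ] (ι → F)) :=
    { toFun := fun x => LinearMap.toContinuousLinearMap (realAction x)
      map_add' := fun x y => ContinuousLinearMap.ext (Matrix.add_mulVec x y)
      map_smul' := fun c x => ContinuousLinearMap.ext (Matrix.smul_mulVec c x) }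
  exact ContinuousLinearMap.continuous_det.comp T.continuous_of_finiteDimensional

end RealDet

/-! ### Unitary matrices and Gram volumes -/

section HilbertSchmidt

variable {F : ScalarField} {ι ι' κ : Type} [Fintype ι] [Fintype ι'] [Fintype κ]

/-- The square of the Hilbert-Schmidt norm, the exponent of the Gaussian densities below. -/
def normSq (Z : ι → κ → F) : ℝ := ∑ i, ∑ j, ‖Z i j‖ ^ 2

theorem algebraMap_normSq (Z : Matrix ι κ F) : algebraMap ℝ F (normSq Z) = (Zᴴ * Z).trace := by
  simp only [normSq, trace, diag, Matrix.mul_apply, conjTranspose_apply, star_mul_self_eq,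
    map_sum]
  exact Finset.sum_comm

theorem normSq_congr {Z : Matrix ι κ F} {Z' : Matrix ι' κ F}
    (h : Zᴴ * Z = Z'ᴴ * Z') : normSq Z = normSq Z' := by
  apply (algebraMap ℝ F).injective
  rw [algebraMap_normSq, algebraMap_normSq, h]

theorem normSq_isometry_mul [DecidableEq κ] {μ : Type} [Fintype μ] {V : Matrix ι κ F}
    (hV : Vᴴ * V = 1) (Z : Matrix κ μ F) : normSq (V * Z) = normSq Z := by
  apply normSq_congr
  rw [conjTranspose_mul, Matrix.mul_assoc, ← Matrix.mul_assoc Vᴴ, hV, Matrix.one_mul]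

theorem normSq_conjTranspose (Z : Matrix ι κ F) : normSq Zᴴ = normSq Z := by
  simp only [normSq, conjTranspose_apply, norm_star]
  exact Finset.sum_comm

theorem conjTranspose_mul_self_eq_zero_iff {κ : Type} {Z : Matrix ι κ F} :
    Zᴴ * Z = 0 ↔ Z = 0 := by
  refine ⟨fun h => ?_, fun h => by simp [h]⟩
  ext i j
  have hcol : ∑ i, ‖Z i j‖ ^ 2 = 0 := by
    apply (algebraMap ℝ F).injective
    simpa [Matrix.mul_apply, star_mul_self_eq] using congrFun₂ h j j
  simpa using congrFun ((Fintype.sum_eq_zero_iff_of_nonneg fun i => sq_nonneg ‖Z i j‖).1 hcol) i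

theorem eq_of_conjTranspose_mul_eq {κ : Type} {V E : Matrix ι κ F}
    (hVE : Vᴴ * V = Eᴴ * E) (hEV : Eᴴ * V = Eᴴ * E) : V = E := by
  have hVE' : Vᴴ * E = Eᴴ * E := by
    have h := congrArg conjTranspose hEV
    rwa [conjTranspose_mul, conjTranspose_mul, conjTranspose_conjTranspose] at h
  rw [← sub_eq_zero, ← conjTranspose_mul_self_eq_zero_iff, conjTranspose_sub, Matrix.sub_mul,
    Matrix.mul_sub, Matrix.mul_sub, hVE, hVE', hEV, sub_self]

end HilbertSchmidt

section Unitary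

variable {F : ScalarField} {ι κ : Type} [Fintype ι] [DecidableEq ι] [Fintype κ] [DecidableEq κ]

theorem mem_unitary_of_star_mul_self {R : Type*} [Monoid R] [StarMul R] [IsDedekindFiniteMonoid R]
    {U : R} (hU : star U * U = 1) : U ∈ unitary R :=
  ⟨hU, mul_eq_one_comm.1 hU⟩

theorem normSq_unitary_mul {κ : Type} [Fintype κ] {U : Matrix ι ι F}
    (hU : U ∈ unitary (Matrix ι ι F)) (Z : Matrix ι κ F) : normSq (U * Z) = normSq Z :=
  normSq_isometry_mul hU.1 Z

theorem normSq_mul_unitary {ι : Type} [Fintype ι] {U : Matrix κ κ F}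
    (hU : U ∈ unitary (Matrix κ κ F)) (Z : Matrix ι κ F) : normSq (Z * U) = normSq Z := by
  rw [← normSq_conjTranspose, conjTranspose_mul, ← star_eq_conjTranspose U,
    normSq_unitary_mul (Unitary.star_mem hU), normSq_conjTranspose]

/-- `U` is the generalized reflection `1 - W C W*` along `W = V - E`. -/
theorem exists_unitary_mul_eq_of_mul_eq_one {V E : Matrix ι κ F} (hVE : Vᴴ * V = Eᴴ * E)
    {C : Matrix κ κ F} (hC : C * (Eᴴ * E - Eᴴ * V) = 1) :
    ∃ U ∈ unitary (Matrix ι ι F), U * V = E := by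
  set A := Eᴴ * E - Eᴴ * V with hA
  set W := V - E with hW
  have hAC : A * C = 1 := mul_eq_one_comm.1 hC
  have hWV : Wᴴ * V = A := by rw [hW, conjTranspose_sub, Matrix.sub_mul, hVE]
  have hWW : Wᴴ * W = A + Aᴴ := by
    rw [hW, hA]
    simp only [conjTranspose_sub, conjTranspose_mul, conjTranspose_conjTranspose,
      Matrix.sub_mul, Matrix.mul_sub, hVE]
    abel
  have hCAC : Cᴴ * (A + Aᴴ) * C = Cᴴ + C := by
    rw [Matrix.mul_add, Matrix.add_mul, Matrix.mul_assoc, hAC, Matrix.mul_one,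
      ← conjTranspose_mul, hAC, conjTranspose_one, Matrix.one_mul]
  have hsquare : (W * Cᴴ * Wᴴ) * (W * C * Wᴴ) = W * Cᴴ * Wᴴ + W * C * Wᴴ := by
    calc (W * Cᴴ * Wᴴ) * (W * C * Wᴴ) = W * (Cᴴ * (Wᴴ * W) * C) * Wᴴ := by
          simp only [Matrix.mul_assoc]
      _ = _ := by rw [hWW, hCAC, Matrix.mul_add, Matrix.add_mul]
  refine ⟨1 - W * C * Wᴴ, mem_unitary_of_star_mul_self ?_, ?_⟩
  · rw [star_eq_conjTranspose]
    simp only [conjTranspose_sub, conjTranspose_one, conjTranspose_mul,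
      conjTranspose_conjTranspose, ← Matrix.mul_assoc W, Matrix.sub_mul, Matrix.mul_sub,
      Matrix.one_mul, Matrix.mul_one, hsquare]
    abel
  · rw [Matrix.sub_mul, Matrix.one_mul, Matrix.mul_assoc, Matrix.mul_assoc, hWV, hC,
      Matrix.mul_one, hW, sub_sub_cancel]

theorem exists_mul_eq_one_of_ne_zero {A : Matrix Unit Unit F} (hA : A ≠ 0) :
    ∃ C, C * A = 1 := by
  have h : A () () ≠ 0 := fun h => hA (Matrix.ext fun _ _ => h)
  refine ⟨Matrix.of fun _ _ => (A () ())⁻¹, Matrix.ext fun _ _ => ?_⟩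
  simp [Matrix.mul_apply, h]

theorem exists_unitary_mulVec_eq {v w : ι → F} (h : ∑ i, ‖v i‖ ^ 2 = ∑ i, ‖w i‖ ^ 2) :
    ∃ U ∈ unitary (Matrix ι ι F), U *ᵥ v = w := by
  have hgram : ∀ u : ι → F, (replicateCol Unit u)ᴴ * replicateCol Unit u =
      Matrix.of fun _ _ => algebraMap ℝ F (∑ i, ‖u i‖ ^ 2) := fun u => by
    ext
    simp [Matrix.mul_apply, star_mul_self_eq]
  set V := replicateCol Unit v
  set E := replicateCol Unit w
  have hVE : Vᴴ * V = Eᴴ * E := by rw [hgram, hgram, h]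
  obtain ⟨U, hU, hUV⟩ : ∃ U ∈ unitary (Matrix ι ι F), U * V = E := by
    by_cases hA : Eᴴ * E - Eᴴ * V = 0
    · exact ⟨1, one_mem _, (Matrix.one_mul V).trans
        (eq_of_conjTranspose_mul_eq hVE (sub_eq_zero.1 hA).symm)⟩
    · obtain ⟨C, hC⟩ := exists_mul_eq_one_of_ne_zero hA
      exact exists_unitary_mul_eq_of_mul_eq_one hVE hC
  refine ⟨U, hU, replicateCol_injective (ι := Unit) ?_⟩
  rw [replicateCol_mulVec, hUV]

theorem exists_unitary_vecMul_eq {v w : ι → F} (h : ∑ i, ‖v i‖ ^ 2 = ∑ i, ‖w i‖ ^ 2) :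
    ∃ U ∈ unitary (Matrix ι ι F), v ᵥ* U = w := by
  obtain ⟨U, hU, hUv⟩ := exists_unitary_mulVec_eq (v := star v) (w := star w) (by simpa using h)
  refine ⟨star U, Unitary.star_mem hU, ?_⟩
  rw [star_eq_conjTranspose, ← star_star v, ← star_mulVec, hUv, star_star]

end Unitary

section Gram

variable {F : ScalarField} {ι κ : Type} [Fintype ι] [Fintype κ] [DecidableEq κ]

/-- `|det_ℝ Z|`, for a square matrix given as a family of rows (the form in which matrices carry a
measure). -/
def absDet (Z : κ → κ → F) : ℝ := |realDet (Matrix.of Z)|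

/-- The volume `|det_ℝ (Z* Z)|^{1/2}` spanned by the columns of a rectangular matrix; it extends
`absDet`. -/
def gramVol (Z : ι → κ → F) : ℝ := √|realDet ((Matrix.of Z)ᴴ * Matrix.of Z)|

theorem absDet_nonneg (Z : κ → κ → F) : 0 ≤ absDet Z := abs_nonneg _

theorem absDet_mul (Z W : Matrix κ κ F) : absDet (Z * W) = absDet Z * absDet W :=
  (congrArg _ (map_mul realDet Z W)).trans (abs_mul _ _)

theorem absDet_of_mem_unitary {U : Matrix κ κ F} (hU : U ∈ unitary (Matrix κ κ F)) :
    absDet U = 1 :=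
  abs_realDet_of_mem_unitary hU

@[fun_prop]
theorem continuous_absDet : Continuous (absDet : (κ → κ → F) → ℝ) :=
  continuous_abs.comp continuous_realDet

@[fun_prop]
theorem continuous_gramVol : Continuous (gramVol : (ι → κ → F) → ℝ) := by
  have h : Continuous fun Z : ι → κ → F => (Matrix.of Z)ᴴ * Matrix.of Z :=
    (Continuous.matrix_conjTranspose (A := fun Z : ι → κ → F => Matrix.of Z)
      continuous_id).matrix_mul continuous_id
  exact (continuous_abs.comp (continuous_realDet.comp h)).sqrt

theorem gramVol_mul (Z : Matrix ι κ F) (W : Matrix κ κ F) :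
    gramVol (Z * W) = gramVol Z * absDet W := by
  change √|realDet ((Z * W)ᴴ * (Z * W))| = √|realDet (Zᴴ * Z)| * |realDet W|
  rw [conjTranspose_mul, Matrix.mul_assoc, ← Matrix.mul_assoc Zᴴ, map_mul, map_mul,
    ← star_eq_conjTranspose, realDet_star, mul_left_comm, abs_mul, abs_mul_self,
    Real.sqrt_mul (abs_nonneg _), Real.sqrt_mul_self_eq_abs]

theorem gramVol_of_isometry {V : Matrix ι κ F} (hV : Vᴴ * V = 1) : gramVol V = 1 := by
  change √|realDet (Vᴴ * V)| = 1
  rw [hV, map_one, abs_one, Real.sqrt_one]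

end Gram

/-! ### Triangular form under the action of the unitary group -/

section PosDet

variable {F : ScalarField} {ι κ : Type} [Fintype ι] [DecidableEq ι] [Fintype κ] [DecidableEq κ]

open scoped ComplexOrder in
/-- The (Dieudonné) determinant is a positive real number. Unlike `det_ℝ`, this sees the phase of a
complex determinant, so that it can single out `SU` in the unitary group. -/
def PosDet (F : ScalarField) {ι : Type} [Fintype ι] [DecidableEq ι] : Matrix ι ι F → Prop :=
  match F with
  | .real => fun x : Matrix ι ι ℝ => 0 < x.det
  | .complex => fun x : Matrix ι ι ℂ => 0 < x.det
  | .quaternion => fun x => 0 < realDet x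

open scoped ComplexOrder in
theorem PosDet.submatrix {x : Matrix ι ι F} (h : PosDet F x) (e : κ ≃ ι) :
    PosDet F (x.submatrix e e) := by
  match F, x, h with
  | .real, x, h => exact h.trans_eq (Matrix.det_submatrix_equiv_self (R := ℝ) e x).symm
  | .complex, x, h => exact h.trans_eq (Matrix.det_submatrix_equiv_self (R := ℂ) e x).symm
  | .quaternion, x, h => exact h.trans_eq (realDet_submatrix e x).symm

open scoped ComplexOrder in
theorem PosDet.fromBlocks {a : Matrix ι ι F} {b : Matrix κ κ F} (ha : PosDet F a)
    (hb : PosDet F b) (X : Matrix ι κ F) : PosDet F (fromBlocks a X 0 b) := by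
  have hC {y z : ℂ} (hy : 0 < y) (hz : 0 < z) : 0 < y * z := mul_pos hy hz
  match F, a, b, X, ha, hb with
  | .real, a, b, X, ha, hb =>
    exact (mul_pos ha hb).trans_eq (Matrix.det_fromBlocks_zero₂₁ (R := ℝ) a X b).symm
  | .complex, a, b, X, ha, hb =>
    exact (hC ha hb).trans_eq (Matrix.det_fromBlocks_zero₂₁ (R := ℂ) a X b).symm
  | .quaternion, a, b, X, ha, hb =>
    exact (mul_pos ha hb).trans_eq (realDet_fromBlocks a X b).symm

open scoped ComplexOrder in
theorem posDet_smul_one {r : ℝ} (hr : 0 < r) : PosDet F (r • (1 : Matrix ι ι F)) := by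
  have hR : 0 < (r • (1 : Matrix ι ι ℝ)).det := by
    rw [Matrix.det_smul, Matrix.det_one, mul_one]
    positivity
  have hC : 0 < (r • (1 : Matrix ι ι ℂ)).det := by
    rw [Matrix.det_smul_of_tower, Matrix.det_one, Complex.real_smul, mul_one]
    exact_mod_cast pow_pos hr _
  match F with
  | .real => exact hR
  | .complex => exact hC
  | .quaternion =>
    change 0 < realDet _
    rw [realDet_smul_one]
    positivity

theorem posDet_of_isEmpty [IsEmpty ι] (x : Matrix ι ι F) : PosDet F x := by
  rw [Subsingleton.elim x ((1 : ℝ) • 1)]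
  exact posDet_smul_one one_pos

open scoped ComplexOrder in
theorem det_eq_one_of_mem_unitary_of_pos {𝕜 : Type*} [RCLike 𝕜] {U : Matrix ι ι 𝕜}
    (hU : U ∈ unitary (Matrix ι ι 𝕜)) (hpos : 0 < U.det) : U.det = 1 := by
  have hnorm : ‖U.det‖ * ‖U.det‖ = 1 := by
    have h := congrArg det hU.1
    rw [det_mul, star_eq_conjTranspose, det_conjTranspose, det_one] at h
    simpa using congrArg norm h
  obtain ⟨r, hr, hdet⟩ := RCLike.pos_iff_exists_ofReal.1 hpos
  rw [← hdet, RCLike.norm_ofReal, abs_of_pos hr, mul_self_eq_one_iff] at hnorm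
  rw [← hdet, hnorm.resolve_right (by linarith), RCLike.ofReal_one]

open scoped ComplexOrder in
theorem mem_specialLinear_of_posDet {U x : (Matrix ι ι F)ˣ} (hU : U.val ∈ unitary (Matrix ι ι F))
    (hx : x ∈ specialLinear F ι) (hpos : PosDet F (U.val * x.val)) : U ∈ specialLinear F ι := by
  match F, U, x, hU, hx, hpos with
  | .real, U, x, hU, hx, hpos =>
    refine det_eq_one_of_mem_unitary_of_pos (𝕜 := ℝ) hU (hpos.trans_eq ?_)
    exact (det_mul (R := ℝ) U.val x.val).trans ((congrArg _ hx).trans (mul_one _))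
  | .complex, U, x, hU, hx, hpos =>
    refine det_eq_one_of_mem_unitary_of_pos (𝕜 := ℂ) hU (hpos.trans_eq ?_)
    exact (det_mul (R := ℂ) U.val x.val).trans ((congrArg _ hx).trans (mul_one _))
  | .quaternion, U, x, hU, hx, hpos =>
    have hU_pos : 0 < realDet U.val :=
      hpos.trans_eq ((map_mul realDet _ _).trans ((congrArg _ hx).trans (mul_one _)))
    exact (abs_of_pos hU_pos).symm.trans (abs_realDet_of_mem_unitary hU)

end PosDet

section Triangular

variable {F : ScalarField} {ι κ : Type} [Fintype ι] [DecidableEq ι] [Fintype κ] [DecidableEq κ]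

theorem submatrix_mem_unitary {U : Matrix ι ι F} (hU : U ∈ unitary (Matrix ι ι F)) (e : κ ≃ ι) :
    U.submatrix e e ∈ unitary (Matrix κ κ F) := by
  apply mem_unitary_of_star_mul_self
  rw [star_eq_conjTranspose, conjTranspose_submatrix, submatrix_mul_equiv,
    ← star_eq_conjTranspose, hU.1, submatrix_one_equiv]

theorem fromBlocks_one_mem_unitary {U : Matrix κ κ F} (hU : U ∈ unitary (Matrix κ κ F)) :
    fromBlocks (1 : Matrix ι ι F) 0 0 U ∈ unitary (Matrix (ι ⊕ κ) (ι ⊕ κ) F) := by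
  apply mem_unitary_of_star_mul_self
  rw [star_eq_conjTranspose, fromBlocks_conjTranspose, fromBlocks_multiply,
    ← star_eq_conjTranspose U, hU.1]
  simp

theorem d_pos (F : ScalarField) : 0 < F.d := Module.finrank_pos

theorem exists_unitary_mul_eq_fromBlocks {x : Matrix (Unit ⊕ ι) (Unit ⊕ ι) F}
    (hx : realDet x ≠ 0) : ∃ U ∈ unitary (Matrix (Unit ⊕ ι) (Unit ⊕ ι) F),
      ∃ r : ℝ, 0 < r ∧ ∃ X y, U * x = fromBlocks (r • 1) X 0 y := by
  set r := √(∑ i, ‖x.col (Sum.inl ()) i‖ ^ 2) with hr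
  obtain ⟨U, hU, hcol⟩ := exists_unitary_mulVec_eq (v := x.col (Sum.inl ()))
    (w := Pi.single (Sum.inl ()) (algebraMap ℝ F r)) (by
      have hsum : 0 ≤ ∑ i, ‖x.col (Sum.inl ()) i‖ ^ 2 := Finset.sum_nonneg fun _ _ => sq_nonneg _
      rw [← Real.sq_sqrt hsum, ← hr, Finset.sum_eq_single (Sum.inl ()) (by simp_all) (by simp),
        Pi.single_eq_same, norm_algebraMap', Real.norm_eq_abs, sq_abs])
  have hblocks : U * x =
      fromBlocks (r • 1) (U * x).toBlocks₁₂ 0 (U * x).toBlocks₂₂ := by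
    conv_lhs => rw [← fromBlocks_toBlocks (U * x)]
    congr 1 <;> ext i j
    · exact (congrFun hcol (Sum.inl i)).trans (by simp [Algebra.algebraMap_eq_smul_one])
    · exact (congrFun hcol (Sum.inr i)).trans (by simp)
  refine ⟨U, hU, r, (Real.sqrt_nonneg _).lt_of_ne' fun hr0 => ?_, _, _, hblocks⟩
  have hUx : realDet (U * x) ≠ 0 := by
    rw [map_mul]
    exact mul_ne_zero (abs_ne_zero.1 (by simp [abs_realDet_of_mem_unitary hU])) hx
  rw [hblocks, realDet_fromBlocks, realDet_smul_one, hr.trans hr0] at hUx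
  simp [(d_pos F).ne'] at hUx

/-- The first index and the remaining ones, in the order needed to split off the first row and
column as blocks. -/
def headTail (n : ℕ) : Unit ⊕ Fin n ≃ Fin (n + 1) where
  toFun := Sum.elim (fun _ => 0) Fin.succ
  invFun := Fin.cases (Sum.inl ()) Sum.inr
  left_inv := by rintro (_ | i) <;> rfl
  right_inv := by intro i; refine Fin.cases ?_ (fun i => ?_) i <;> rfl

@[simp]
theorem headTail_symm_zero (n : ℕ) : (headTail n).symm 0 = Sum.inl () := rfl

@[simp]
theorem headTail_symm_succ (n : ℕ) (i : Fin n) : (headTail n).symm i.succ = Sum.inr i := rfl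

theorem blockTriangular_headTail {n : ℕ} (a : Matrix Unit Unit F) (X : Matrix Unit (Fin n) F)
    {y : Matrix (Fin n) (Fin n) F} (hy : y.BlockTriangular id) :
    ((fromBlocks a X 0 y).submatrix (headTail n).symm (headTail n).symm).BlockTriangular id := by
  intro i j
  refine Fin.cases ?_ (fun i => ?_) i <;> refine Fin.cases ?_ (fun j => ?_) j
  · simp
  · simp
  · simp
  · intro hij
    simpa using hy (Fin.succ_lt_succ_iff.1 hij)

theorem exists_unitary_mul_blockTriangular {n : ℕ} {x : Matrix (Fin n) (Fin n) F}
    (hx : realDet x ≠ 0) : ∃ U ∈ unitary (Matrix (Fin n) (Fin n) F),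
      PosDet F (U * x) ∧ (U * x).BlockTriangular id := by
  induction n with
  | zero => exact ⟨1, one_mem _, posDet_of_isEmpty _, fun i => i.elim0⟩
  | succ n ih =>
    let e := headTail n
    have hx' : realDet (x.submatrix e e) ≠ 0 := by rwa [realDet_submatrix]
    obtain ⟨U₁, hU₁, r, hr, X, y, hblocks⟩ := exists_unitary_mul_eq_fromBlocks hx'
    have hy : realDet y ≠ 0 := by
      have h : realDet (U₁ * x.submatrix e e) ≠ 0 := by
        rw [map_mul]
        exact mul_ne_zero (abs_ne_zero.1 (by simp [abs_realDet_of_mem_unitary hU₁])) hx'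
      rw [hblocks, realDet_fromBlocks] at h
      exact right_ne_zero_of_mul h
    obtain ⟨U₂, hU₂, hpos, htri⟩ := ih hy
    set U := fromBlocks 1 0 0 U₂ * U₁
    have hUx : U.submatrix e.symm e.symm * x =
        (fromBlocks (r • 1) X 0 (U₂ * y)).submatrix e.symm e.symm := by
      have hUxe : U * x.submatrix e e = fromBlocks (r • 1) X 0 (U₂ * y) := by
        rw [Matrix.mul_assoc, hblocks, fromBlocks_multiply]
        simp
      rw [← hUxe, ← submatrix_mul_equiv U _ e.symm e.symm e.symm, submatrix_submatrix,
        e.self_comp_symm, submatrix_id_id]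
    refine ⟨U.submatrix e.symm e.symm, submatrix_mem_unitary
      (mul_mem (fromBlocks_one_mem_unitary hU₂) hU₁) e.symm, ?_, ?_⟩
    · rw [hUx]
      exact ((posDet_smul_one hr).fromBlocks hpos X).submatrix e.symm
    · rw [hUx]
      exact blockTriangular_headTail _ _ htri

end Triangular

/-! ### The decompositions `N̄MAN` and `KMAN` -/

section Decompositions

variable {F : ScalarField} {p q : ℕ}

theorem G.mat_mul (x y : G F p q) : (x * y).mat = x.mat * y.mat := rfl

theorem G.realDet_mat_ne_zero (x : G F p q) : realDet x.mat ≠ 0 :=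
  realDet_ne_zero (x : (Mat F p q)ˣ)

theorem G.mat_mem_unitary {k : G F p q} (hk : k ∈ K F p q) : k.mat ∈ unitary (Mat F p q) :=
  mem_unitary_of_star_mul_self hk

theorem aMat_mul_aMat (s t : ℝ) : aMat F p q s * aMat F p q t = aMat F p q (s + t) := by
  simp only [aMat_eq, fromBlocks_multiply, Matrix.mul_zero, Matrix.zero_mul, add_zero, zero_add,
    smul_mul_smul_comm, Matrix.mul_one, ← Real.exp_add, ← add_mul]

theorem aMat_zero : aMat F p q 0 = 1 := by
  simp [aMat_eq]

variable (F p q) in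
/-- `exp (t H_o)` as an invertible matrix. -/
def aUnit (t : ℝ) : (Mat F p q)ˣ where
  val := aMat F p q t
  inv := aMat F p q (-t)
  val_inv := by rw [aMat_mul_aMat, add_neg_cancel, aMat_zero]
  inv_val := by rw [aMat_mul_aMat, neg_add_cancel, aMat_zero]

theorem mem_specialLinear_of_fromBlocks_smul_one {r s : ℝ} (h : r ^ p * s ^ q = 1)
    {u : (Mat F p q)ˣ} (hu : u.val = fromBlocks (r • 1) 0 0 (s • 1)) :
    u ∈ specialLinear F (Fin p ⊕ Fin q) := by
  have hR :
      (fromBlocks (r • 1) 0 0 (s • 1) : Matrix (Fin p ⊕ Fin q) (Fin p ⊕ Fin q) ℝ).det = 1 := by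
    rw [det_fromBlocks_zero₂₁, det_smul, det_smul]
    simpa using h
  have hC :
      (fromBlocks (r • 1) 0 0 (s • 1) : Matrix (Fin p ⊕ Fin q) (Fin p ⊕ Fin q) ℂ).det = 1 := by
    rw [det_fromBlocks_zero₂₁, det_smul_of_tower, det_smul_of_tower]
    simpa [← Complex.ofReal_pow, ← Complex.ofReal_mul] using h
  match F, u, hu with
  | .real, u, hu => exact (congrArg (Matrix.det (R := ℝ)) hu).trans hR
  | .complex, u, hu => exact (congrArg (Matrix.det (R := ℂ)) hu).trans hC
  | .quaternion, u, hu =>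
    change realDet u.val = 1
    rw [hu, realDet_fromBlocks_diagonal, realDet_smul_one, realDet_smul_one, Fintype.card_fin,
      Fintype.card_fin, mul_comm _ p, mul_comm _ q, pow_mul, pow_mul, ← mul_pow, h, one_pow]

theorem aUnit_mem_specialLinear (t : ℝ) : aUnit F p q t ∈ specialLinear F (Fin p ⊕ Fin q) := by
  refine mem_specialLinear_of_fromBlocks_smul_one ?_ (aMat_eq F p q t)
  rw [← Real.exp_nat_mul, ← Real.exp_nat_mul, ← Real.exp_add, Real.exp_eq_one_iff]
  ring

variable (F p q) in
/-- The weight `dpq/(n+1)` by which `H_o` acts on `|det_ℝ|` of the upper left block. -/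
def blockWeight : ℝ := F.d * p * q / (p + q)

theorem blockWeight_pos (hp : 1 ≤ p) (hq : 1 ≤ q) : 0 < blockWeight F p q := by
  have := d_pos F
  unfold blockWeight
  positivity

theorem realDet_exp_smul_one (t : ℝ) :
    realDet (Real.exp (t * (q / (p + q))) • (1 : Matrix (Fin p) (Fin p) F)) =
      Real.exp (t * blockWeight F p q) := by
  rw [realDet_smul_one, ← Real.exp_nat_mul, Fintype.card_fin, blockWeight]
  congr 1
  push_cast
  ring

theorem exists_mat_eq_of_mat_eq_fromBlocks (hp : 1 ≤ p) (hq : 1 ≤ q) {y : G F p q}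
    {a : Matrix (Fin p) (Fin p) F} {X : Matrix (Fin p) (Fin q) F} {b : Matrix (Fin q) (Fin q) F}
    (hy : y.mat = fromBlocks a X 0 b) :
    ∃ t, ∃ m ∈ M F p q, ∃ X', y.mat = m.mat * aMat F p q t * nMat X' := by
  have ha : realDet a ≠ 0 := by
    have h := y.realDet_mat_ne_zero
    rw [hy, realDet_fromBlocks] at h
    exact left_ne_zero_of_mul h
  obtain ⟨u, rfl⟩ := isUnit_of_realDet_ne_zero ha
  set t := Real.log |realDet u.val| / blockWeight F p q
  have ht : t * blockWeight F p q = Real.log |realDet u.val| :=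
    div_mul_cancel₀ _ (blockWeight_pos hp hq).ne'
  let n : G F p q := ⟨unipotentUnit (u⁻¹.val * X), unipotentUnit_mem_specialLinear _⟩
  let c : G F p q := ⟨aUnit F p q t, aUnit_mem_specialLinear t⟩
  refine ⟨t, y * n⁻¹ * c⁻¹, ⟨Real.exp (-t * (q / (p + q))) • u.val,
    Real.exp (-t * -(p / (p + q))) • b, ?_, ?_⟩, u⁻¹.val * X, ?_⟩
  · change y.mat * nMat (-(u⁻¹.val * X)) * aMat F p q (-t) = _
    rw [hy, aMat_eq, nMat, fromBlocks_multiply, fromBlocks_multiply]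
    simp [← Matrix.mul_assoc]
  · rw [← Matrix.one_mul u.val, ← Matrix.smul_mul, map_mul, realDet_exp_smul_one, abs_mul,
      Real.abs_exp, neg_mul, ht, Real.exp_neg, Real.exp_log (abs_pos.2 ha),
      inv_mul_cancel₀ (abs_ne_zero.2 ha)]
  · exact congrArg G.mat (by group : y = y * n⁻¹ * c⁻¹ * c * n)

theorem exists_mat_eq_fromBlocks_of_mem_M {m : G F p q} (hm : m ∈ M F p q) (t : ℝ)
    (X : Matrix (Fin p) (Fin q) F) :
    ∃ a Y b, m.mat * aMat F p q t * nMat X = fromBlocks a Y 0 b ∧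
      |realDet a| = Real.exp (t * blockWeight F p q) := by
  obtain ⟨a, b, hab, ha⟩ := hm
  refine ⟨a * (Real.exp (t * (q / (p + q))) • 1), a * (Real.exp (t * (q / (p + q))) • 1) * X,
    b * (Real.exp (t * -(p / (p + q))) • 1), ?_, ?_⟩
  · rw [hab, aMat_eq, nMat, fromBlocks_multiply, fromBlocks_multiply]
    simp only [Matrix.mul_zero, Matrix.zero_mul, add_zero, zero_add, Matrix.mul_one]
  · rw [map_mul, abs_mul, ha, one_mul, realDet_exp_smul_one, Real.abs_exp]

theorem exists_isAlpha (hp : 1 ≤ p) (hq : 1 ≤ q) {x : G F p q}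
    (hx : absDet x.mat.toBlocks₁₁ ≠ 0) : ∃ t, IsAlpha x t := by
  obtain ⟨u, hu⟩ := isUnit_of_realDet_ne_zero (abs_ne_zero.1 hx)
  set Y := x.mat.toBlocks₂₁ * u⁻¹.val
  have hy : ((nbar Y)⁻¹ * x).mat = fromBlocks u.val x.mat.toBlocks₁₂ 0
      (-Y * x.mat.toBlocks₁₂ + x.mat.toBlocks₂₂) := by
    change nbarMat (-Y) * x.mat = _
    conv_lhs => rw [← fromBlocks_toBlocks x.mat, nbarMat, fromBlocks_multiply]
    rw [show x.mat.toBlocks₁₁ = u.val from hu.symm]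
    simp [Y, Matrix.mul_assoc]
  obtain ⟨t, m, hm, X, h⟩ := exists_mat_eq_of_mat_eq_fromBlocks hp hq hy
  refine ⟨t, Y, m, X, hm, ?_⟩
  rw [Matrix.mul_assoc, Matrix.mul_assoc, ← Matrix.mul_assoc m.mat, ← h]
  exact congrArg G.mat (mul_inv_cancel_left (nbar Y) x).symm

theorem exists_mem_K_mul_eq_fromBlocks (x : G F p q) :
    ∃ k ∈ K F p q, ∃ a X b, (k * x).mat = fromBlocks a X 0 b := by
  let e : Fin p ⊕ Fin q ≃ Fin (p + q) := finSumFinEquiv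
  obtain ⟨V, hV, hpos, htri⟩ := exists_unitary_mul_blockTriangular
    (x := x.mat.submatrix e.symm e.symm) (by rw [realDet_submatrix]; exact x.realDet_mat_ne_zero)
  have hU : V.submatrix e e ∈ unitary (Mat F p q) := submatrix_mem_unitary hV e
  have hUx : V.submatrix e e * x.mat = (V * x.mat.submatrix e.symm e.symm).submatrix e e := by
    rw [← submatrix_mul_equiv _ _ e e e, submatrix_submatrix, e.symm_comp_self, submatrix_id_id]
  let u : (Mat F p q)ˣ := ⟨V.submatrix e e, star (V.submatrix e e), hU.2, hU.1⟩
  have hu : u ∈ specialLinear F (Fin p ⊕ Fin q) :=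
    mem_specialLinear_of_posDet hU x.2 (hUx ▸ hpos.submatrix e)
  refine ⟨⟨u, hu⟩, hU.1, (V.submatrix e e * x.mat).toBlocks₁₁,
    (V.submatrix e e * x.mat).toBlocks₁₂, (V.submatrix e e * x.mat).toBlocks₂₂, ?_⟩
  have h₂₁ : (V.submatrix e e * x.mat).toBlocks₂₁ = 0 := by
    ext i j
    rw [hUx]
    exact htri (Fin.lt_def.2 (by simp [e]; omega))
  conv_rhs => rw [← h₂₁]
  exact (fromBlocks_toBlocks _).symm

theorem exists_isIwasawa (hp : 1 ≤ p) (hq : 1 ≤ q) (x : G F p q) : ∃ t, IsIwasawa x t := by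
  obtain ⟨k, hk, a, X, b, hkx⟩ := exists_mem_K_mul_eq_fromBlocks x
  obtain ⟨t, m, hm, X', h⟩ := exists_mat_eq_of_mat_eq_fromBlocks hp hq hkx
  refine ⟨t, k⁻¹, m, X', inv_mem hk, hm, ?_⟩
  rw [Matrix.mul_assoc, Matrix.mul_assoc, ← Matrix.mul_assoc m.mat, ← h]
  exact congrArg G.mat (inv_mul_cancel_left k x).symm

end Decompositions

section Frame

variable {F : ScalarField} {p q : ℕ}

/-- The first `p` columns of a matrix. They determine its class in `G / P` (the point of the
Grassmann manifold that they span) and its `A`-components. -/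
def frame (x : Mat F p q) : Matrix (Fin p ⊕ Fin q) (Fin p) F := x.submatrix id Sum.inl

theorem frame_mul (x y : Mat F p q) : frame (x * y) = x * frame y := rfl

theorem frame_mul_fromBlocks (x : Mat F p q) (a : Matrix (Fin p) (Fin p) F)
    (X : Matrix (Fin p) (Fin q) F) (b : Matrix (Fin q) (Fin q) F) :
    frame (x * fromBlocks a X 0 b) = frame x * a := by
  ext i j
  simp [frame, Matrix.mul_apply]

theorem conjTranspose_frame_mul_frame {k : G F p q} (hk : k ∈ K F p q) :
    (frame k.mat)ᴴ * frame k.mat = 1 := by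
  have h : (frame k.mat)ᴴ * frame k.mat = (star k.mat * k.mat).toBlocks₁₁ := rfl
  rw [h, hk, ← fromBlocks_one, toBlocks_fromBlocks₁₁]

theorem gramVol_frame_of_mem_K {k : G F p q} (hk : k ∈ K F p q) : gramVol (frame k.mat) = 1 :=
  gramVol_of_isometry (conjTranspose_frame_mul_frame hk)

theorem gramVol_frame_mul {k : G F p q} (hk : k ∈ K F p q) (b : Matrix (Fin p) (Fin p) F) :
    gramVol (frame k.mat * b) = absDet b := by
  rw [gramVol_mul, gramVol_frame_of_mem_K hk, one_mul]

theorem exists_frame_eq_frame_mul (x : G F p q) :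
    ∃ k ∈ K F p q, ∃ b : Matrix (Fin p) (Fin p) F, frame x.mat = frame k.mat * b := by
  obtain ⟨k, hk, a, X, b, hkx⟩ := exists_mem_K_mul_eq_fromBlocks x
  refine ⟨k⁻¹, inv_mem hk, a, ?_⟩
  rw [← frame_mul_fromBlocks _ a X b, ← hkx]
  exact congrArg (fun y : G F p q => frame y.mat) (inv_mul_cancel_left k x).symm

theorem absDet_eq_gramVol_frame {x k : G F p q} (hk : k ∈ K F p q) {b : Matrix (Fin p) (Fin p) F}
    (h : frame x.mat = frame k.mat * b) : absDet b = gramVol (frame x.mat) := by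
  rw [h, gramVol_frame_mul hk]

theorem IsAlpha.absDet_eq {x : G F p q} {t : ℝ} (h : IsAlpha x t) :
    absDet x.mat.toBlocks₁₁ = Real.exp (t * blockWeight F p q) := by
  obtain ⟨Y, m, X, hm, hx⟩ := h
  obtain ⟨a, X', b, hab, ha⟩ := exists_mat_eq_fromBlocks_of_mem_M hm t X
  rw [Matrix.mul_assoc, Matrix.mul_assoc, ← Matrix.mul_assoc m.mat, hab, nbarMat,
    fromBlocks_multiply] at hx
  rw [hx, toBlocks_fromBlocks₁₁, Matrix.one_mul, Matrix.zero_mul, add_zero, ← ha]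
  rfl

theorem IsIwasawa.gramVol_frame_eq {x : G F p q} {t : ℝ} (h : IsIwasawa x t) :
    gramVol (frame x.mat) = Real.exp (t * blockWeight F p q) := by
  obtain ⟨k, m, X, hk, hm, hx⟩ := h
  obtain ⟨a, X', b, hab, ha⟩ := exists_mat_eq_fromBlocks_of_mem_M hm t X
  rw [Matrix.mul_assoc, Matrix.mul_assoc, ← Matrix.mul_assoc m.mat, hab] at hx
  rw [hx, frame_mul_fromBlocks, gramVol_frame_mul hk, ← ha]
  rfl

theorem gramVol_frame_pos (hp : 1 ≤ p) (hq : 1 ≤ q) (x : G F p q) : 0 < gramVol (frame x.mat) := by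
  obtain ⟨t, ht⟩ := exists_isIwasawa hp hq x
  exact ht.gramVol_frame_eq ▸ Real.exp_pos _

theorem aPow_eq_cpow (F : ScalarField) (p q : ℕ) (t : ℝ) (z : ℂ) :
    aPow p q t z = (Real.exp (t * blockWeight F p q) : ℂ) ^ (z / F.d) := by
  have hd : (F.d : ℂ) ≠ 0 := by exact_mod_cast (d_pos F).ne'
  rw [aPow, Complex.cpow_def_of_ne_zero (by exact_mod_cast (Real.exp_pos _).ne'),
    ← Complex.ofReal_log (Real.exp_pos _).le, Real.log_exp, blockWeight]
  congr 1
  push_cast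
  field_simp

theorem alphaPow_eq_cpow (hp : 1 ≤ p) (hq : 1 ≤ q) {x : G F p q}
    (hx : absDet x.mat.toBlocks₁₁ ≠ 0) (z : ℂ) :
    alphaPow x z = (absDet x.mat.toBlocks₁₁ : ℂ) ^ (z / F.d) := by
  have h := exists_isAlpha hp hq hx
  rw [alphaPow, dif_pos h, aPow_eq_cpow F, h.choose_spec.absDet_eq]

theorem iwasawaPow_eq_cpow (hp : 1 ≤ p) (hq : 1 ≤ q) (x : G F p q) (z : ℂ) :
    iwasawaPow x z = (gramVol (frame x.mat) : ℂ) ^ (z / F.d) := by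
  have h := exists_isIwasawa hp hq x
  rw [iwasawaPow, dif_pos h, aPow_eq_cpow F, h.choose_spec.gramVol_frame_eq]

end Frame

/-! ### Lebesgue and Gaussian measures on matrices -/

open scoped ENNReal

section WithDensity

variable {α β : Type} [MeasurableSpace α] [MeasurableSpace β]

theorem measurePreserving_withDensity {μ : Measure α} {ν : Measure β} {f : α → β}
    (h : MeasurePreserving f μ ν) {g : β → ℝ≥0∞} (hg : Measurable g) :
    MeasurePreserving f (μ.withDensity fun x => g (f x)) (ν.withDensity g) := by
  refine ⟨h.measurable, Measure.ext fun s hs => ?_⟩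
  rw [Measure.map_apply h.measurable hs, withDensity_apply _ (h.measurable hs),
    withDensity_apply _ hs, h.setLIntegral_comp_preimage hs hg]

/-- The Gaussian measure `exp(-N(x)) dx`, not normalized; `N` is a squared Euclidean norm, which on
matrix spaces is not the square of the instance norm. -/
def gaussMeasure {E : Type} [MeasureSpace E] (N : E → ℝ) : Measure E :=
  volume.withDensity fun x => ENNReal.ofReal (Real.exp (-N x))

section GaussMeasure

variable {E : Type} [MeasureSpace E] {N : E → ℝ}

theorem lintegral_gaussMeasure (hN : Measurable N) {f : E → ℝ≥0∞} (hf : Measurable f) :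
    ∫⁻ x, f x ∂gaussMeasure N = ∫⁻ x, f x * ENNReal.ofReal (Real.exp (-N x)) := by
  rw [gaussMeasure, lintegral_withDensity_eq_lintegral_mul _ (by fun_prop) hf]
  simp only [Pi.mul_apply, mul_comm]

theorem integrable_gaussMeasure_iff (hN : Measurable N) {g : E → ℂ} :
    Integrable g (gaussMeasure N) ↔ Integrable fun x => Real.exp (-N x) • g x := by
  rw [gaussMeasure, integrable_withDensity_iff_integrable_smul' (by fun_prop) (by simp)]
  simp only [ENNReal.toReal_ofReal (Real.exp_pos _).le]

theorem integral_gaussMeasure (hN : Measurable N) (g : E → ℂ) :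
    ∫ x, g x ∂gaussMeasure N = ∫ x, Real.exp (-N x) • g x := by
  rw [gaussMeasure, integral_withDensity_eq_integral_toReal_smul (by fun_prop) (by simp)]
  simp only [ENNReal.toReal_ofReal (Real.exp_pos _).le]

theorem gaussMeasure_absolutelyContinuous : gaussMeasure N ≪ volume :=
  withDensity_absolutelyContinuous _ _

theorem absolutelyContinuous_gaussMeasure (hN : Measurable N) : volume ≪ gaussMeasure N :=
  withDensity_absolutelyContinuous' (by fun_prop)
    (.of_forall fun _ => (ENNReal.ofReal_pos.2 (Real.exp_pos _)).ne')

theorem neZero_gaussMeasure (hN : Measurable N) [NeZero (volume : Measure E)] :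
    NeZero (gaussMeasure N) :=
  ⟨fun h => NeZero.ne (volume : Measure E)
    (Measure.absolutelyContinuous_zero_iff.1 (h ▸ absolutelyContinuous_gaussMeasure hN))⟩

theorem isFiniteMeasure_gaussMeasure (h : Integrable fun x => Real.exp (-N x)) :
    IsFiniteMeasure (gaussMeasure N) :=
  isFiniteMeasure_withDensity
    ((hasFiniteIntegral_iff_ofReal (.of_forall fun _ => (Real.exp_pos _).le)).1 h.2).ne

theorem measurePreserving_gaussMeasure_prod {E₁ E₂ : Type} [MeasureSpace E₁] [MeasureSpace E₂]
    [SFinite (volume : Measure E₁)] [SFinite (volume : Measure E₂)] {N₁ : E₁ → ℝ} {N₂ : E₂ → ℝ}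
    {f : E₁ × E₂ → E} (hf : MeasurePreserving f) (hN : Measurable N) (hN₁ : Measurable N₁)
    (hN₂ : Measurable N₂) (h : ∀ x, N (f x) = N₁ x.1 + N₂ x.2) :
    MeasurePreserving f ((gaussMeasure N₁).prod (gaussMeasure N₂)) (gaussMeasure N) := by
  have hprod : (gaussMeasure N₁).prod (gaussMeasure N₂) =
      volume.withDensity fun x => ENNReal.ofReal (Real.exp (-N (f x))) := by
    rw [gaussMeasure, gaussMeasure, prod_withDensity (by fun_prop) (by fun_prop)]
    simp only [h, neg_add, Real.exp_add, ENNReal.ofReal_mul (Real.exp_pos _).le]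
    rfl
  rw [hprod]
  exact measurePreserving_withDensity hf
    (g := fun x => ENNReal.ofReal (Real.exp (-N x))) (by fun_prop)

end GaussMeasure

end WithDensity

section LinearChange

variable {E : Type} [NormedAddCommGroup E] [NormedSpace ℝ E] [FiniteDimensional ℝ E]
  [MeasureSpace E] [BorelSpace E] [(volume : Measure E).IsAddHaarMeasure]

theorem lintegral_comp_linearMap {L : E →ₗ[ℝ] E} (hL : LinearMap.det L ≠ 0) {f : E → ℝ≥0∞}
    (hf : Measurable f) :
    ∫⁻ x, f (L x) = ENNReal.ofReal |LinearMap.det L|⁻¹ * ∫⁻ x, f x := by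
  have hm : Measurable L := L.continuous_of_finiteDimensional.measurable
  rw [← lintegral_map hf hm, Measure.map_linearMap_addHaar_eq_smul_addHaar volume hL,
    lintegral_smul_measure, abs_inv, smul_eq_mul]

theorem measurePreserving_gaussMeasure_linearMap {L : E →ₗ[ℝ] E} (hL : |LinearMap.det L| = 1)
    {N : E → ℝ} (hN : Measurable N) (h : ∀ x, N (L x) = N x) :
    MeasurePreserving L (gaussMeasure N) (gaussMeasure N) := by
  have hL0 : LinearMap.det L ≠ 0 := abs_ne_zero.1 (hL.trans_ne one_ne_zero)
  have hvol : MeasurePreserving L :=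
    ⟨L.continuous_of_finiteDimensional.measurable, by
      rw [Measure.map_linearMap_addHaar_eq_smul_addHaar volume hL0, abs_inv, hL, inv_one,
        ENNReal.ofReal_one, one_smul]⟩
  have hgauss := measurePreserving_withDensity hvol
    (g := fun x => ENNReal.ofReal (Real.exp (-N x))) (by fun_prop)
  simp only [h] at hgauss
  exact hgauss

end LinearChange

section Lebesgue

variable {F : ScalarField} {ι κ : Type} [Fintype ι] [Fintype κ]

instance (F : ScalarField) : MeasureSpace F where
  volume := Measure.addHaar

instance (F : ScalarField) : (volume : Measure F).IsAddHaarMeasure :=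
  inferInstanceAs (Measure.addHaar : Measure F).IsAddHaarMeasure

instance : (volume : Measure (κ → F)).IsAddHaarMeasure :=
  inferInstanceAs (Measure.pi fun _ : κ => (volume : Measure F)).IsAddHaarMeasure

instance : (volume : Measure (ι → κ → F)).IsAddHaarMeasure :=
  Measure.pi.isAddHaarMeasure (fun _ : ι => (volume : Measure (κ → F)))

/-- Right multiplication by a square matrix, on matrices given as families of rows. -/
def rightMul {ι : Type} [DecidableEq κ] (a : Matrix κ κ F) : (ι → κ → F) →ₗ[ℝ] (ι → κ → F) :=
  LinearMap.pi fun i => (rowAction a).comp (LinearMap.proj i)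

theorem det_rightMul [DecidableEq κ] (a : Matrix κ κ F) :
    LinearMap.det (rightMul a : (ι → κ → F) →ₗ[ℝ] (ι → κ → F)) =
      realDet a ^ Fintype.card ι := by
  rw [rightMul, LinearMap.det_pi, Finset.prod_const, det_rowAction, Finset.card_univ]

/-- Left multiplication by a square matrix, on matrices given as families of rows. -/
def leftMul {κ : Type} (a : Matrix ι ι F) : (ι → κ → F) →ₗ[ℝ] (ι → κ → F) where
  toFun Z := a * Matrix.of Z
  map_add' Z W := Matrix.mul_add a (Matrix.of Z) (Matrix.of W)
  map_smul' r Z := Matrix.mul_smul a r (Matrix.of Z)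

theorem leftMul_apply {κ : Type} (a : Matrix ι ι F) (Z : ι → κ → F) :
    leftMul a Z = a * Matrix.of Z := rfl

/-- The conjugate transpose as an `ℝ`-linear equivalence, on matrices given as families of rows. It
exchanges left and right multiplications. -/
def conjTransposeEquiv (F : ScalarField) (ι κ : Type) : (κ → ι → F) ≃ₗ[ℝ] (ι → κ → F) where
  toFun Z := (Matrix.of Z)ᴴ
  invFun Z := (Matrix.of Z)ᴴ
  left_inv Z := conjTranspose_conjTranspose (Matrix.of Z)
  right_inv Z := conjTranspose_conjTranspose (Matrix.of Z)
  map_add' Z W := conjTranspose_add (Matrix.of Z) (Matrix.of W)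
  map_smul' r Z := by
    funext i j
    exact star_smul r (Z j i)

theorem det_leftMul [DecidableEq ι] (a : Matrix ι ι F) :
    LinearMap.det (leftMul a : (ι → κ → F) →ₗ[ℝ] (ι → κ → F)) = realDet a ^ Fintype.card κ := by
  rw [← realDet_star, ← det_rightMul (ι := κ),
    ← LinearMap.det_conj (rightMul (star a)) (conjTransposeEquiv F ι κ)]
  congr 1
  refine LinearMap.ext fun Z => ?_
  change a * Matrix.of Z = ((Matrix.of Z)ᴴ * aᴴ)ᴴ
  rw [conjTranspose_mul, conjTranspose_conjTranspose, conjTranspose_conjTranspose]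

theorem lintegral_comp_rightMul [DecidableEq κ] {a : Matrix κ κ F} (ha : realDet a ≠ 0)
    {f : (ι → κ → F) → ℝ≥0∞} (hf : Measurable f) :
    ∫⁻ Z : ι → κ → F, f (rightMul a Z) =
      ENNReal.ofReal (absDet a ^ Fintype.card ι)⁻¹ * ∫⁻ Z, f Z := by
  rw [lintegral_comp_linearMap (by rw [det_rightMul]; exact pow_ne_zero _ ha) hf, det_rightMul,
    abs_pow]
  rfl

theorem lintegral_comp_leftMul [DecidableEq ι] {a : Matrix ι ι F} (ha : realDet a ≠ 0)
    {f : (ι → κ → F) → ℝ≥0∞} (hf : Measurable f) :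
    ∫⁻ Z : ι → κ → F, f (leftMul a Z) =
      ENNReal.ofReal (absDet a ^ Fintype.card κ)⁻¹ * ∫⁻ Z, f Z := by
  rw [lintegral_comp_linearMap (by rw [det_leftMul]; exact pow_ne_zero _ ha) hf, det_leftMul,
    abs_pow]
  rfl

end Lebesgue

section GaussMatrix

variable {F : ScalarField} {ι κ : Type} [Fintype ι] [Fintype κ]

/-- The squared Euclidean norm of a vector over `𝕂`. -/
def vecNormSq (v : κ → F) : ℝ := ∑ j, ‖v j‖ ^ 2

/-- The Gaussian measure on row vectors, not normalized. -/
abbrev gaussRow (F : ScalarField) (κ : Type) [Fintype κ] : Measure (κ → F) :=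
  gaussMeasure vecNormSq

/-- The Gaussian measure on matrices, not normalized. -/
abbrev gaussMat (F : ScalarField) (ι κ : Type) [Fintype ι] [Fintype κ] : Measure (ι → κ → F) :=
  gaussMeasure normSq

@[fun_prop]
theorem continuous_vecNormSq : Continuous (vecNormSq : (κ → F) → ℝ) := by
  unfold vecNormSq
  fun_prop

@[fun_prop]
theorem continuous_normSq : Continuous (normSq : (ι → κ → F) → ℝ) := by
  unfold normSq
  fun_prop

theorem vecNormSq_nonneg (v : κ → F) : 0 ≤ vecNormSq v :=
  Finset.sum_nonneg fun _ _ => sq_nonneg _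

theorem vecNormSq_eq_zero_iff {v : κ → F} : vecNormSq v = 0 ↔ v = 0 := by
  simp [vecNormSq, Finset.sum_eq_zero_iff_of_nonneg, funext_iff]

theorem vecNormSq_single [DecidableEq κ] (i : κ) (x : F) : vecNormSq (Pi.single i x) = ‖x‖ ^ 2 := by
  rw [vecNormSq, Finset.sum_eq_single i (fun j _ hj => by simp [hj]) (by simp), Pi.single_eq_same]

theorem integrable_exp_neg_norm_sq : Integrable fun x : F => Real.exp (-‖x‖ ^ 2) := by
  refine (integrable_fun_norm_addHaar volume (f := fun y => Real.exp (-y ^ 2))).2 ?_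
  have h := integrableOn_rpow_mul_exp_neg_mul_sq one_pos
    (s := ((Module.finrank ℝ F - 1 : ℕ) : ℝ)) (neg_one_lt_zero.trans_le (Nat.cast_nonneg _))
  refine h.congr_fun (fun y _ => ?_) measurableSet_Ioi
  simp [Real.rpow_natCast]

theorem integrable_exp_neg_vecNormSq :
    Integrable fun v : κ → F => Real.exp (-vecNormSq v) := by
  have h : Integrable fun v : κ → F => ∏ j, Real.exp (-‖v j‖ ^ 2) :=
    Integrable.fintype_prod (f := fun (_ : κ) (x : F) => Real.exp (-‖x‖ ^ 2))
      (μ := fun _ => volume) fun _ => integrable_exp_neg_norm_sq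
  simpa only [vecNormSq, ← Finset.sum_neg_distrib, Real.exp_sum] using h

theorem integrable_exp_neg_normSq : Integrable fun Z : ι → κ → F => Real.exp (-normSq Z) := by
  have h : Integrable fun Z : ι → κ → F => ∏ i, Real.exp (-vecNormSq (Z i)) :=
    Integrable.fintype_prod (f := fun (_ : ι) (v : κ → F) => Real.exp (-vecNormSq v))
      (μ := fun _ => volume) fun _ => integrable_exp_neg_vecNormSq
  simpa only [normSq, vecNormSq, ← Finset.sum_neg_distrib, Real.exp_sum] using h

instance : IsFiniteMeasure (gaussRow F κ) :=
  isFiniteMeasure_gaussMeasure integrable_exp_neg_vecNormSq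

instance : IsFiniteMeasure (gaussMat F ι κ) :=
  isFiniteMeasure_gaussMeasure integrable_exp_neg_normSq

instance : NeZero (gaussRow F κ) := neZero_gaussMeasure (by fun_prop)

instance : NeZero (gaussMat F ι κ) := neZero_gaussMeasure (by fun_prop)

theorem measurePreserving_rightMul [DecidableEq κ] {U : Matrix κ κ F}
    (hU : U ∈ unitary (Matrix κ κ F)) :
    MeasurePreserving (rightMul U) (gaussMat F ι κ) (gaussMat F ι κ) := by
  refine measurePreserving_gaussMeasure_linearMap ?_ (by fun_prop) (normSq_mul_unitary hU)
  rw [det_rightMul, abs_pow, abs_realDet_of_mem_unitary hU, one_pow]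

theorem measurePreserving_leftMul [DecidableEq ι] {U : Matrix ι ι F}
    (hU : U ∈ unitary (Matrix ι ι F)) :
    MeasurePreserving (leftMul U) (gaussMat F ι κ) (gaussMat F ι κ) := by
  refine measurePreserving_gaussMeasure_linearMap ?_ (by fun_prop) (normSq_unitary_mul hU)
  rw [det_leftMul, abs_pow, abs_realDet_of_mem_unitary hU, one_pow]

theorem measurePreserving_cons_rows (n : ℕ) :
    MeasurePreserving (fun x : (κ → F) × (Fin n → κ → F) => (Fin.cons x.1 x.2 : Fin (n + 1) → _))
      ((gaussRow F κ).prod (gaussMat F (Fin n) κ)) (gaussMat F (Fin (n + 1)) κ) := by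
  refine measurePreserving_gaussMeasure_prod ?_ (by fun_prop) (by fun_prop) (by fun_prop)
    fun x => by simp [normSq, vecNormSq, Fin.sum_univ_succ]
  simpa [MeasurableEquiv.piFinSuccAbove, Fin.insertNthEquiv] using
    (volume_preserving_piFinSuccAbove (fun _ : Fin (n + 1) => κ → F) 0).symm

theorem measurePreserving_cons_columns (n : ℕ) :
    MeasurePreserving (fun x : (ι → F) × (ι → Fin n → F) =>
        (fun i => Fin.cons (x.1 i) (x.2 i) : ι → Fin (n + 1) → F))
      ((gaussRow F ι).prod (gaussMat F ι (Fin n))) (gaussMat F ι (Fin (n + 1))) := by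
  refine measurePreserving_gaussMeasure_prod ?_ (by fun_prop) (by fun_prop) (by fun_prop)
    fun x => by simp [normSq, vecNormSq, Fin.sum_univ_succ, Finset.sum_add_distrib]
  have hcons : MeasurePreserving (fun (x : ι → F × (Fin n → F)) i =>
      (MeasurableEquiv.piFinSuccAbove (fun _ : Fin (n + 1) => F) 0).symm (x i)) :=
    measurePreserving_pi _ _ fun _ =>
      (volume_preserving_piFinSuccAbove (fun _ : Fin (n + 1) => (F : Type)) 0).symm
  have h := hcons.comp (volume_measurePreserving_arrowProdEquivProdArrow F (Fin n → F) ι).symm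
  simpa [Function.comp_def, MeasurableEquiv.piFinSuccAbove, Fin.insertNthEquiv,
    MeasurableEquiv.arrowProdEquivProdArrow, Equiv.arrowProdEquivProdArrow] using h

theorem measurePreserving_sumElim_rows {ι' : Type} [Fintype ι'] :
    MeasurePreserving (fun x : (ι → κ → F) × (ι' → κ → F) => (Sum.elim x.1 x.2 : ι ⊕ ι' → κ → F))
      ((gaussMat F ι κ).prod (gaussMat F ι' κ)) (gaussMat F (ι ⊕ ι') κ) := by
  refine measurePreserving_gaussMeasure_prod ?_ (by fun_prop) (by fun_prop) (by fun_prop)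
    fun x => by simp [normSq]
  exact volume_measurePreserving_sumPiEquivProdPi_symm fun _ : ι ⊕ ι' => κ → F

end GaussMatrix

/-! ### The determinant of a Gaussian matrix -/

section Recursion

variable {F : ScalarField}

theorem absDet_cons_single {n : ℕ} {r : ℝ} (hr : 0 ≤ r) (w : Fin n → F) (Z : Fin n → Fin n → F) :
    absDet (Fin.cons (Pi.single 0 (algebraMap ℝ F r)) fun i => Fin.cons (w i) (Z i)) =
      r ^ F.d * absDet Z := by
  have h : (Matrix.of (Fin.cons (Pi.single 0 (algebraMap ℝ F r)) fun i => Fin.cons (w i) (Z i)) :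
      Matrix (Fin (n + 1)) (Fin (n + 1)) F) =
        (fromBlocks (r • 1 : Matrix Unit Unit F) 0 (Matrix.of fun i _ => w i)
          (Matrix.of Z)).submatrix (headTail n).symm (headTail n).symm := by
    ext i j
    refine Fin.cases ?_ (fun i => ?_) i <;> refine Fin.cases ?_ (fun j => ?_) j <;>
      simp [Algebra.algebraMap_eq_smul_one]
  rw [absDet, h, realDet_submatrix, ← realDet_star, star_eq_conjTranspose,
    fromBlocks_conjTranspose, conjTranspose_zero, realDet_fromBlocks, ← star_eq_conjTranspose,
    ← star_eq_conjTranspose, realDet_star, realDet_star, realDet_smul_one, abs_mul,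
    Fintype.card_unit, mul_one, abs_of_nonneg (pow_nonneg hr _)]
  rfl

theorem lintegral_absDet_cons {n : ℕ} (z : Fin (n + 1) → F) {f : ℝ → ℝ≥0∞} (hf : Measurable f) :
    ∫⁻ Z, f (absDet (Fin.cons z Z)) ∂gaussMat F (Fin n) (Fin (n + 1)) =
      gaussRow F (Fin n) Set.univ *
        ∫⁻ Z, f (√(vecNormSq z) ^ F.d * absDet Z) ∂gaussMat F (Fin n) (Fin n) := by
  set r := √(vecNormSq z)
  obtain ⟨U, hU, hzU⟩ := exists_unitary_vecMul_eq (v := z)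
    (w := Pi.single 0 (algebraMap ℝ F r)) (by
      change vecNormSq z = vecNormSq _
      rw [vecNormSq_single, norm_algebraMap', Real.norm_eq_abs, sq_abs,
        Real.sq_sqrt (vecNormSq_nonneg z)])
  have hdet (Z : Fin n → Fin (n + 1) → F) : absDet (Fin.cons z Z) =
      absDet (Fin.cons (Pi.single 0 (algebraMap ℝ F r)) (rightMul U Z)) := by
    have hmul : Matrix.of (Fin.cons (Pi.single 0 (algebraMap ℝ F r)) (rightMul U Z)) =
        Matrix.of (Fin.cons z Z) * U := by
      ext i j
      refine Fin.cases ?_ (fun i => ?_) i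
      · exact congrFun hzU.symm j
      · rfl
    exact ((congrArg (|realDet ·|) hmul).trans ((absDet_mul _ U).trans
      (by rw [absDet_of_mem_unitary hU, mul_one]; rfl))).symm
  simp only [hdet]
  rw [(measurePreserving_rightMul hU).lintegral_comp
      (f := fun Z => f (absDet (Fin.cons (Pi.single 0 (algebraMap ℝ F r)) Z))) (by fun_prop),
    ← (measurePreserving_cons_columns n).lintegral_comp (by fun_prop),
    lintegral_prod _ (by fun_prop)]
  simp only [absDet_cons_single (r := r) (Real.sqrt_nonneg _), lintegral_const, mul_comm]

theorem map_absDet_gaussMat_succ (n : ℕ) :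
    (gaussMat F (Fin (n + 1)) (Fin (n + 1))).map absDet =
      gaussRow F (Fin n) Set.univ • ((gaussRow F (Fin (n + 1))).prod
        (gaussMat F (Fin n) (Fin n))).map fun x => √(vecNormSq x.1) ^ F.d * absDet x.2 := by
  refine Measure.ext_of_lintegral _ fun f hf => ?_
  rw [lintegral_map hf (by fun_prop), lintegral_smul_measure, lintegral_map hf (by fun_prop),
    lintegral_prod _ (by fun_prop), ← (measurePreserving_cons_rows n).lintegral_comp (by fun_prop),
    lintegral_prod _ (by fun_prop), smul_eq_mul, ← lintegral_const_mul _ (by fun_prop)]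
  exact lintegral_congr fun z => lintegral_absDet_cons z hf

theorem absDet_of_isEmpty {κ : Type} [Fintype κ] [DecidableEq κ] [IsEmpty κ] (Z : κ → κ → F) :
    absDet Z = 1 := by
  rw [absDet, Subsingleton.elim (Matrix.of Z) 1, map_one, abs_one]

theorem ae_absDet_ne_zero (n : ℕ) : ∀ᵐ Z ∂gaussMat F (Fin n) (Fin n), absDet Z ≠ 0 := by
  have hmeas : MeasurableSet {x : ℝ | x ≠ 0} := (measurableSet_singleton 0).compl
  induction n with
  | zero => simp [absDet_of_isEmpty]
  | succ n ih =>
    suffices ∀ᵐ x ∂(gaussMat F (Fin (n + 1)) (Fin (n + 1))).map absDet, x ≠ 0 from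
      ae_of_ae_map (f := absDet) (by fun_prop) this
    have hz : ∀ᵐ z ∂gaussRow F (Fin (n + 1)), z ≠ 0 :=
      gaussMeasure_absolutelyContinuous.ae_le (Measure.ae_ne volume 0)
    rw [map_absDet_gaussMat_succ]
    refine Measure.ae_smul_measure ?_ _
    rw [ae_map_iff (by fun_prop) hmeas]
    filter_upwards [Measure.quasiMeasurePreserving_fst.ae hz,
      Measure.quasiMeasurePreserving_snd.ae ih] with x hx₁ hx₂
    have hpos : 0 < vecNormSq x.1 :=
      (vecNormSq_nonneg _).lt_of_ne' fun h => hx₁ (vecNormSq_eq_zero_iff.1 h)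
    exact mul_ne_zero (pow_ne_zero _ (Real.sqrt_pos.2 hpos).ne') hx₂

end Recursion

/-! ### Moments -/

section HasMoment

variable {α β : Type} [MeasurableSpace α] [MeasurableSpace β] {μ : Measure α} {ν : Measure β}
  {f : α → ℝ} {g : β → ℝ} {s a b : ℂ}

/-- The `s`-th moment of `f` under `μ` converges absolutely and is equal to `a`; meant for
nonnegative `f`, since `(f x : ℂ) ^ s` is a principal value. -/
def HasMoment (μ : Measure α) (f : α → ℝ) (s a : ℂ) : Prop :=
  Integrable (fun x => (f x : ℂ) ^ s) μ ∧ ∫ x, (f x : ℂ) ^ s ∂μ = a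

theorem hasMoment_map_iff {φ : β → α} (hφ : Measurable φ) (hf : Measurable f) :
    HasMoment (ν.map φ) f s a ↔ HasMoment ν (fun x => f (φ x)) s a := by
  have hpow : AEStronglyMeasurable (fun x => (f x : ℂ) ^ s) (ν.map φ) :=
    (hf.complex_ofReal.pow_const s).aestronglyMeasurable
  rw [HasMoment, HasMoment, integrable_map_measure hpow hφ.aemeasurable,
    integral_map hφ.aemeasurable hpow]
  rfl

theorem HasMoment.smul_measure (h : HasMoment μ f s a) {c : ℝ≥0∞} (hc : c ≠ ∞) :
    HasMoment (c • μ) f s (c.toReal * a) :=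
  ⟨h.1.smul_measure hc, by rw [integral_smul_measure, h.2, Complex.real_smul]⟩

theorem ofReal_mul_cpow {x y : ℝ} (hx : 0 ≤ x) (hy : 0 ≤ y) (s : ℂ) :
    ((x * y : ℝ) : ℂ) ^ s = (x : ℂ) ^ s * (y : ℂ) ^ s := by
  rw [Complex.ofReal_mul, Complex.mul_cpow_ofReal_nonneg hx hy]

theorem HasMoment.mul_prod [SFinite μ] [SFinite ν] (hf : HasMoment μ f s a)
    (hg : HasMoment ν g s b) (hf_nonneg : ∀ x, 0 ≤ f x) (hg_nonneg : ∀ y, 0 ≤ g y) :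
    HasMoment (μ.prod ν) (fun x => f x.1 * g x.2) s (a * b) := by
  simp only [HasMoment, ofReal_mul_cpow (hf_nonneg _) (hg_nonneg _)]
  exact ⟨hf.1.mul_prod hg.1, by
    rw [integral_prod_mul (fun x => (f x : ℂ) ^ s) (fun y => (g y : ℂ) ^ s), hf.2, hg.2]⟩

theorem HasMoment.of_mul_prod [SFinite μ] [SFinite ν] {c : ℂ}
    (h : HasMoment (μ.prod ν) (fun x => f x.1 * g x.2) s c) (hg : HasMoment ν g s b) (hb : b ≠ 0)
    (hf_nonneg : ∀ x, 0 ≤ f x) (hg_nonneg : ∀ y, 0 ≤ g y) : HasMoment μ f s (c / b) := by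
  simp only [HasMoment, ofReal_mul_cpow (hf_nonneg _) (hg_nonneg _)] at h
  refine ⟨?_, ?_⟩
  · simpa only [integral_const_mul, hg.2, mul_div_cancel_right₀ _ hb] using
      h.1.integral_prod_left.div_const b
  · rw [← h.2, integral_prod_mul (fun x => (f x : ℂ) ^ s) (fun y => (g y : ℂ) ^ s), hg.2,
      mul_div_cancel_right₀ _ hb]

theorem hasMoment_withDensity_pow_iff (hf : Measurable f) (hf_pos : ∀ᵐ x ∂μ, 0 < f x) (n : ℕ) :
    HasMoment (μ.withDensity fun x => ENNReal.ofReal (f x ^ n)) f s a ↔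
      HasMoment μ f (s + n) a := by
  have hpow : (fun x => (ENNReal.ofReal (f x ^ n)).toReal • (f x : ℂ) ^ s) =ᵐ[μ]
      fun x => (f x : ℂ) ^ (s + n) := by
    filter_upwards [hf_pos] with x hx
    rw [ENNReal.toReal_ofReal (pow_pos hx n).le, Complex.real_smul, Complex.ofReal_pow, mul_comm,
      Complex.cpow_add _ _ (Complex.ofReal_ne_zero.2 hx.ne'), Complex.cpow_natCast]
  rw [HasMoment, integrable_withDensity_iff_integrable_smul' (by fun_prop) (by simp),
    integral_withDensity_eq_integral_toReal_smul (by fun_prop) (by simp), integrable_congr hpow,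
    integral_congr_ae hpow, HasMoment]

theorem HasMoment.measureReal_univ (h : HasMoment μ f 0 a) : (μ.real Set.univ : ℂ) = a := by
  simpa [HasMoment] using h.2

end HasMoment

/-! ### Moments of the determinant of a Gaussian matrix -/

section RadialMoments

theorem mellin_exp_neg_sq {s : ℂ} (hs : 0 < s.re) :
    IntegrableOn (fun y : ℝ => (y : ℂ) ^ (s - 1) * Real.exp (-y ^ 2)) (Set.Ioi 0) ∧
      ∫ y : ℝ in Set.Ioi 0, (y : ℂ) ^ (s - 1) * Real.exp (-y ^ 2) =
        2⁻¹ * Complex.Gamma (s / 2) := by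
  have hs' : 0 < (s / ((2 : ℝ) : ℂ)).re := by
    rw [Complex.div_ofReal_re]
    positivity
  have hexp : MellinConvergent (fun x : ℝ => ((Real.exp (-x) : ℝ) : ℂ)) (s / ((2 : ℝ) : ℂ)) := by
    refine (Complex.GammaIntegral_convergent hs').congr_fun (fun x _ => ?_) measurableSet_Ioi
    simp [mul_comm]
  have hconv := (MellinConvergent.comp_rpow (two_ne_zero (α := ℝ))).2 hexp
  have hval := mellin_comp_rpow (fun x : ℝ => ((Real.exp (-x) : ℝ) : ℂ)) s 2
  rw [← Complex.GammaIntegral_eq_mellin, ← Complex.Gamma_eq_integral hs'] at hval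
  exact ⟨by simpa [MellinConvergent] using hconv, by simpa [mellin] using hval⟩

variable {E : Type} [NormedAddCommGroup E] [NormedSpace ℝ E] [FiniteDimensional ℝ E]
  [MeasurableSpace E] [BorelSpace E]

theorem integral_exp_neg_norm_sq_smul_cpow_norm [Nontrivial E] (μ : Measure E)
    [μ.IsAddHaarMeasure] {s : ℂ} (hs : 0 < (Module.finrank ℝ E + s).re) :
    Integrable (fun x : E => Real.exp (-‖x‖ ^ 2) • (‖x‖ : ℂ) ^ s) μ ∧
      ∫ x, Real.exp (-‖x‖ ^ 2) • (‖x‖ : ℂ) ^ s ∂μ =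
        (Module.finrank ℝ E * μ.real (Metric.ball 0 1) / 2 : ℝ) *
          Complex.Gamma ((Module.finrank ℝ E + s) / 2) := by
  obtain ⟨hint, hval⟩ := mellin_exp_neg_sq hs
  have hcongr : Set.EqOn (fun y : ℝ => (y : ℂ) ^ (Module.finrank ℝ E + s - 1) * Real.exp (-y ^ 2))
      (fun y => y ^ (Module.finrank ℝ E - 1) • Real.exp (-y ^ 2) • (y : ℂ) ^ s) (Set.Ioi 0) := by
    intro y hy
    have hpow : (y : ℂ) ^ (Module.finrank ℝ E + s - 1) =
        (y : ℂ) ^ (Module.finrank ℝ E - 1) * (y : ℂ) ^ s := by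
      rw [← Complex.cpow_natCast, ← Complex.cpow_add _ _ (Complex.ofReal_ne_zero.2 (ne_of_gt hy)),
        Nat.cast_pred Module.finrank_pos]
      ring_nf
    simp only [hpow, Complex.real_smul, Complex.ofReal_pow]
    ring
  refine ⟨(integrable_fun_norm_addHaar μ (f := fun y => Real.exp (-y ^ 2) • (y : ℂ) ^ s)).2
    (hint.congr_fun hcongr measurableSet_Ioi), ?_⟩
  rw [integral_fun_norm_addHaar μ (fun y => Real.exp (-y ^ 2) • (y : ℂ) ^ s),
    ← setIntegral_congr_fun measurableSet_Ioi hcongr, hval]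
  simp only [nsmul_eq_mul, Complex.real_smul]
  push_cast
  ring

end RadialMoments

section GaussMoments

variable {F : ScalarField}

theorem exists_gaussRow_moment_eq (κ : Type) [Fintype κ] [Nonempty κ] :
    ∃ C : ℝ, C ≠ 0 ∧ ∀ s : ℂ, 0 < Fintype.card κ + s.re →
      HasMoment (gaussRow F κ) (fun v => √(vecNormSq v) ^ F.d) s
        (C * Complex.Gamma (F.d * (Fintype.card κ + s) / 2)) := by
  let e : (κ → F) ≃L[ℝ] PiLp 2 fun _ : κ => (F : Type) := (PiLp.continuousLinearEquiv 2 ℝ _).symm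
  let μ : Measure (PiLp 2 fun _ : κ => (F : Type)) := volume.map e
  have hμ : μ.IsAddHaarMeasure := e.isAddHaarMeasure_map volume
  have : Nontrivial (PiLp 2 fun _ : κ => (F : Type)) := e.symm.toEquiv.nontrivial
  have hdim : Module.finrank ℝ (PiLp 2 fun _ : κ => (F : Type)) = F.d * Fintype.card κ := by
    rw [← e.toLinearEquiv.finrank_eq, Module.finrank_pi_fintype, Finset.sum_const,
      Finset.card_univ, smul_eq_mul, mul_comm, ScalarField.d]
  have hnorm (v : κ → F) : ‖e v‖ = √(vecNormSq v) := PiLp.norm_eq_of_L2 _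
  have hpow (s : ℂ) (v : κ → F) : Real.exp (-vecNormSq v) • ((√(vecNormSq v) ^ F.d : ℝ) : ℂ) ^ s =
      Real.exp (-‖e v‖ ^ 2) • (‖e v‖ : ℂ) ^ (F.d * s) := by
    rw [hnorm, Real.sq_sqrt (vecNormSq_nonneg v), ← Real.rpow_natCast,
      ← Complex.cpow_mul_ofReal_nonneg (Real.sqrt_nonneg _), Complex.ofReal_natCast]
  have he : MeasurableEmbedding e := e.toHomeomorph.measurableEmbedding
  refine ⟨F.d * Fintype.card κ * μ.real (Metric.ball 0 1) / 2, ?_, fun s hs => ?_⟩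
  · have hball : 0 < μ.real (Metric.ball 0 1) :=
      ENNReal.toReal_pos (Metric.measure_ball_pos μ 0 one_pos).ne' measure_ball_lt_top.ne
    have := d_pos F
    positivity
  obtain ⟨hint, hval⟩ := integral_exp_neg_norm_sq_smul_cpow_norm μ (s := F.d * s) (by
    have := d_pos F
    simpa [hdim, ← mul_add] using mul_pos (Nat.cast_pos.2 this) hs)
  rw [HasMoment, integrable_gaussMeasure_iff (by fun_prop), integral_gaussMeasure (by fun_prop)]
  simp only [hpow]
  refine ⟨he.integrable_map_iff.1 hint, ?_⟩
  rw [← he.integral_map (fun x => Real.exp (-‖x‖ ^ 2) • (‖x‖ : ℂ) ^ (F.d * s)), hval, hdim]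
  push_cast
  ring_nf

variable (F) in
/-- The Gamma factor in the `s`-th moment of `|det_ℝ|` of a Gaussian `n × n` matrix over `𝕂`. -/
def detGamma (n : ℕ) (s : ℂ) : ℂ := siegelGamma n F.d fun _ => F.d * (n + s) / 2

theorem detGamma_ne_zero (n : ℕ) {s : ℂ} (hs : -1 < s.re) : detGamma F n s ≠ 0 := by
  rw [detGamma, siegelGamma]
  refine Finset.prod_ne_zero_iff.2 fun j _ => Complex.Gamma_ne_zero_of_re_pos ?_
  have hj : (j : ℝ) + 1 ≤ n := by exact_mod_cast j.2
  have hd : (0 : ℝ) < F.d := by exact_mod_cast d_pos F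
  have hre : ((F.d : ℂ) * (n + s) / 2 - (F.d : ℂ) / 2 * (j : ℕ)).re =
      F.d / 2 * (n - j + s.re) := by
    rw [show (F.d : ℂ) * (n + s) / 2 - (F.d : ℂ) / 2 * (j : ℕ) =
      ((F.d / 2 : ℝ) : ℂ) * (n - (j : ℕ) + s) by push_cast; ring, Complex.re_ofReal_mul]
    simp
  rw [hre]
  exact mul_pos (half_pos hd) (by linarith)

theorem siegelGamma_succ (n d : ℕ) (z : ℂ) : siegelGamma (n + 1) d (fun _ => z) =
    Complex.Gamma z * siegelGamma n d (fun _ => z - d / 2) := by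
  rw [siegelGamma, siegelGamma, Fin.prod_univ_succ]
  simp only [Fin.val_zero, Fin.val_succ, Nat.cast_zero, Nat.cast_add, Nat.cast_one]
  ring_nf

theorem exists_gaussMat_moment_eq (n : ℕ) : ∃ C : ℝ, C ≠ 0 ∧ ∀ s : ℂ, -1 < s.re →
    HasMoment (gaussMat F (Fin n) (Fin n)) absDet s (C * detGamma F n s) := by
  induction n with
  | zero =>
    refine ⟨(gaussMat F (Fin 0) (Fin 0)).real Set.univ,
      (ENNReal.toReal_pos (NeZero.ne _) (measure_ne_top _ _)).ne', fun s _ => ?_⟩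
    simp [HasMoment, absDet_of_isEmpty, detGamma, siegelGamma]
  | succ n ih =>
    obtain ⟨C₁, hC₁, hrow⟩ := exists_gaussRow_moment_eq (F := F) (Fin (n + 1))
    obtain ⟨C₂, hC₂, hmat⟩ := ih
    refine ⟨(gaussRow F (Fin n)).real Set.univ * C₁ * C₂, mul_ne_zero (mul_ne_zero
      (ENNReal.toReal_pos (NeZero.ne _) (measure_ne_top _ _)).ne' hC₁) hC₂, fun s hs => ?_⟩
    have hprod := (hrow s (by
      rw [Fintype.card_fin, Nat.cast_succ]
      linarith [n.cast_nonneg (α := ℝ)])).mul_prod (hmat s hs) (fun _ => by positivity)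
      absDet_nonneg
    have hmap := ((hasMoment_map_iff (f := id) (by fun_prop) measurable_id).2 hprod).smul_measure
      (measure_ne_top (gaussRow F (Fin n)) Set.univ)
    rw [← map_absDet_gaussMat_succ, hasMoment_map_iff (by fun_prop) measurable_id] at hmap
    convert hmap using 1
    · rfl
    rw [detGamma, detGamma, siegelGamma_succ, Fintype.card_fin, measureReal_def]
    push_cast
    ring_nf

end GaussMoments

/-! ### The polar substitution on `(p+q) × p` matrices -/

section Polar

variable {F : ScalarField} {p q : ℕ}

/-- `a_P(n̄(Y))`, on the scale of `|det_ℝ|`: the Gram volume of the first `p` columns of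
`n̄(Y)`. -/
def nbarVol (Y : Fin q → Fin p → F) : ℝ := gramVol (frame (nbar (Matrix.of Y)).mat)

theorem G.mat_nbar (Y : Matrix (Fin q) (Fin p) F) : (nbar Y).mat = nbarMat Y := rfl

@[fun_prop]
theorem continuous_nbarVol : Continuous (nbarVol : (Fin q → Fin p → F) → ℝ) := by
  have h : Continuous fun Y : Fin q → Fin p → F => frame (nbar (Matrix.of Y)).mat :=
    (Continuous.matrix_fromBlocks continuous_const continuous_const continuous_id
      continuous_const).matrix_submatrix _ _
  exact continuous_gramVol.comp h

theorem nbarVol_pos (hp : 1 ≤ p) (hq : 1 ≤ q) (Y : Fin q → Fin p → F) : 0 < nbarVol Y :=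
  gramVol_frame_pos hp hq (nbar (Matrix.of Y))

theorem exists_frame_nbar_eq (Y : Fin q → Fin p → F) :
    ∃ k ∈ K F p q, ∃ b : Matrix (Fin p) (Fin p) F,
      frame (nbar (Matrix.of Y)).mat = frame k.mat * b ∧ absDet b = nbarVol Y := by
  obtain ⟨k, hk, b, hb⟩ := exists_frame_eq_frame_mul (nbar (Matrix.of Y))
  exact ⟨k, hk, b, hb, absDet_eq_gramVol_frame hk hb⟩

theorem frame_nbar_mul (Y : Fin q → Fin p → F) (Z : Fin p → Fin p → F) :
    frame (nbar (Matrix.of Y)).mat * Matrix.of Z = Sum.elim Z (rightMul (Matrix.of Z) Y) := by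
  funext i j
  rcases i with i | i
  · simp [frame, G.mat_nbar, nbarMat, Matrix.mul_apply, Matrix.one_apply]
  · change _ = (Matrix.of Y * Matrix.of Z) i j
    simp [frame, G.mat_nbar, nbarMat, Matrix.mul_apply]

theorem measurable_sumElim_rightMul {ι κ : Type} [Fintype κ] [DecidableEq κ] :
    Measurable fun x : (κ → κ → F) × (ι → κ → F) =>
      (Sum.elim x.1 (rightMul (Matrix.of x.1) x.2) : κ ⊕ ι → κ → F) := by
  refine measurable_pi_lambda _ fun i => measurable_pi_lambda _ fun j => ?_
  rcases i with i | i
  · simp only [Sum.elim_inl]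
    fun_prop
  · change Measurable fun x : (κ → κ → F) × (ι → κ → F) => (Matrix.of x.2 * Matrix.of x.1) i j
    simp only [Matrix.mul_apply, Matrix.of_apply]
    fun_prop

theorem lintegral_eq_lintegral_sumElim_rightMul {ι : Type} [Fintype ι]
    {f : (Fin p ⊕ ι → Fin p → F) → ℝ≥0∞} (hf : Measurable f) :
    ∫⁻ Z, f Z = ∫⁻ Y : ι → Fin p → F, ∫⁻ Z : Fin p → Fin p → F,
      ENNReal.ofReal (absDet Z ^ Fintype.card ι) *
        f (Sum.elim Z (rightMul (Matrix.of Z) Y)) := by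
  have hpair := (volume_measurePreserving_sumPiEquivProdPi_symm
    fun _ : Fin p ⊕ ι => Fin p → F)
  have hsubst : ∀ᵐ Z : Fin p → Fin p → F,
      ∫⁻ Z₂ : ι → Fin p → F, f (Sum.elim Z Z₂) = ∫⁻ Y : ι → Fin p → F,
        ENNReal.ofReal (absDet Z ^ Fintype.card ι) *
          f (Sum.elim Z (rightMul (Matrix.of Z) Y)) := by
    filter_upwards [(absolutelyContinuous_gaussMeasure (by fun_prop)).ae_le
      (ae_absDet_ne_zero p)] with Z hZ
    have hpos : 0 < absDet Z ^ Fintype.card ι :=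
      pow_pos ((absDet_nonneg Z).lt_of_ne' hZ) _
    have hm : Measurable fun Z₂ : ι → Fin p → F => f (Sum.elim Z Z₂) :=
      hf.comp (hpair.measurable.comp measurable_prodMk_left)
    rw [lintegral_const_mul' _ _ ENNReal.ofReal_ne_top,
      lintegral_comp_rightMul (a := Matrix.of Z) (abs_ne_zero.1 hZ) hm, ← mul_assoc,
      ← ENNReal.ofReal_mul hpos.le]
    change _ = ENNReal.ofReal (absDet Z ^ Fintype.card ι * (absDet Z ^ Fintype.card ι)⁻¹) * _
    rw [mul_inv_cancel₀ hpos.ne', ENNReal.ofReal_one, one_mul]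
  have hjoint : Measurable fun x : (Fin p → Fin p → F) × (ι → Fin p → F) =>
      ENNReal.ofReal (absDet x.1 ^ Fintype.card ι) *
        f (Sum.elim x.1 (rightMul (Matrix.of x.1) x.2)) :=
    Measurable.mul (by fun_prop) (hf.comp measurable_sumElim_rightMul)
  rw [← hpair.lintegral_comp hf, Measure.volume_eq_prod,
    lintegral_prod (fun x => f _) (hf.comp hpair.measurable).aemeasurable]
  exact (lintegral_congr_ae hsubst).trans (lintegral_lintegral_swap hjoint.aemeasurable)

variable (F p q) in
/-- The measure `a_P(n̄)^{-2ρ} dn̄` on `N̄ ≅ M_{q×p}(𝕂)`, for the Lebesgue measure `dn̄`. -/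
def nbarMeasure : Measure (Fin q → Fin p → F) :=
  volume.withDensity fun Y => ENNReal.ofReal (nbarVol Y ^ (p + q))⁻¹

variable (F p q) in
/-- The Gaussian measure on `p × p` matrices weighted by `|det|^q`: the law of the radial part of a
Gaussian `(p+q) × p` matrix. -/
def detMeasure : Measure (Fin p → Fin p → F) :=
  (gaussMat F (Fin p) (Fin p)).withDensity fun W => ENNReal.ofReal (absDet W ^ q)

instance : SFinite (nbarMeasure F p q) := by
  unfold nbarMeasure
  infer_instance

instance : SFinite (detMeasure F p q) := by
  unfold detMeasure
  infer_instance

theorem lintegral_detMeasure {f : (Fin p → Fin p → F) → ℝ≥0∞} (hf : Measurable f) :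
    ∫⁻ W, f W ∂detMeasure F p q =
      ∫⁻ W, ENNReal.ofReal (absDet W ^ q) * (f W * ENNReal.ofReal (Real.exp (-normSq W))) := by
  rw [detMeasure, lintegral_withDensity_eq_lintegral_mul _ (by fun_prop) hf,
    lintegral_gaussMeasure (by fun_prop) (by fun_prop)]
  simp only [Pi.mul_apply, mul_assoc]

theorem ae_detMeasure_absDet_ne_zero : ∀ᵐ W ∂detMeasure F p q, absDet W ≠ 0 :=
  (withDensity_absolutelyContinuous _ _).ae_le (ae_absDet_ne_zero p)

theorem lintegral_sumElim_rightMul (hp : 1 ≤ p) (hq : 1 ≤ q) (Y : Fin q → Fin p → F)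
    {f : ℝ × ℝ → ℝ≥0∞} (hf : Measurable f) :
    ∫⁻ Z : Fin p → Fin p → F, ENNReal.ofReal (absDet Z ^ q) *
      (f (absDet Z, gramVol (Sum.elim Z (rightMul (Matrix.of Z) Y))) *
        ENNReal.ofReal (Real.exp (-normSq (Sum.elim Z (rightMul (Matrix.of Z) Y))))) =
      ENNReal.ofReal (nbarVol Y ^ (p + q))⁻¹ *
        ∫⁻ W, f (absDet W / nbarVol Y, absDet W) ∂detMeasure F p q := by
  have hpos := nbarVol_pos hp hq Y
  obtain ⟨k, hk, b, hb, hdet⟩ := exists_frame_nbar_eq Y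
  have hpolar (Z : Fin p → Fin p → F) :
      Sum.elim Z (rightMul (Matrix.of Z) Y) = frame k.mat * Matrix.of (leftMul b Z) := by
    rw [← frame_nbar_mul, hb, Matrix.mul_assoc]
    rfl
  have habs (Z : Fin p → Fin p → F) : absDet Z = absDet (leftMul b Z) / nbarVol Y := by
    rw [leftMul_apply, absDet_mul, hdet, mul_div_cancel_left₀ _ hpos.ne']
    rfl
  have hnorm (Z : Fin p → Fin p → F) :
      normSq (Sum.elim Z (rightMul (Matrix.of Z) Y)) = normSq (leftMul b Z) := by
    rw [hpolar]
    exact normSq_isometry_mul (conjTranspose_frame_mul_frame hk) _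
  have hgram (Z : Fin p → Fin p → F) :
      gramVol (Sum.elim Z (rightMul (Matrix.of Z) Y)) = absDet (leftMul b Z) := by
    rw [hpolar]
    exact gramVol_frame_mul hk _
  have hb0 : realDet b ≠ 0 := abs_pos.1 (hpos.trans_eq hdet.symm)
  let g (W : Fin p → Fin p → F) : ℝ≥0∞ := ENNReal.ofReal ((absDet W / nbarVol Y) ^ q) *
    (f (absDet W / nbarVol Y, absDet W) * ENNReal.ofReal (Real.exp (-normSq W)))
  have hg : Measurable g := by fun_prop
  calc _ = ∫⁻ Z, g (leftMul b Z) := by simp only [g, hgram, hnorm, ← habs]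
    _ = ENNReal.ofReal (nbarVol Y ^ p)⁻¹ * ∫⁻ W, g W := by
      rw [lintegral_comp_leftMul hb0 hg, hdet, Fintype.card_fin]
    _ = ENNReal.ofReal (nbarVol Y ^ p)⁻¹ * (ENNReal.ofReal (nbarVol Y ^ q)⁻¹ *
          ∫⁻ W, f (absDet W / nbarVol Y, absDet W) ∂detMeasure F p q) := by
      rw [lintegral_detMeasure (by fun_prop), ← lintegral_const_mul' _ _ ENNReal.ofReal_ne_top,
        ← lintegral_const_mul' _ _ ENNReal.ofReal_ne_top,
        ← lintegral_const_mul' _ _ ENNReal.ofReal_ne_top]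
      simp only [g, div_pow, div_eq_inv_mul _ (nbarVol Y ^ q), mul_assoc,
        ENNReal.ofReal_mul (inv_nonneg.2 (pow_nonneg hpos.le q))]
    _ = _ := by rw [pow_add, mul_inv, ENNReal.ofReal_mul (by positivity), mul_assoc]

theorem map_absDet_gramVol (hp : 1 ≤ p) (hq : 1 ≤ q) :
    (gaussMat F (Fin p ⊕ Fin q) (Fin p)).map
        (fun Z => (absDet fun i => Z (Sum.inl i), gramVol Z)) =
      ((nbarMeasure F p q).prod (detMeasure F p q)).map
        fun x => (absDet x.2 / nbarVol x.1, absDet x.2) := by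
  refine Measure.ext_of_lintegral _ fun f hf => ?_
  have hf' : Measurable fun x : (Fin q → Fin p → F) × (Fin p → Fin p → F) =>
      f (absDet x.2 / nbarVol x.1, absDet x.2) := by fun_prop
  rw [lintegral_map hf (by fun_prop), lintegral_gaussMeasure (by fun_prop) (by fun_prop),
    lintegral_eq_lintegral_sumElim_rightMul (by fun_prop), lintegral_map hf (by fun_prop),
    lintegral_prod _ hf'.aemeasurable, nbarMeasure,
    lintegral_withDensity_eq_lintegral_mul _ (by fun_prop) hf'.lintegral_prod_right',
    Fintype.card_fin]
  exact lintegral_congr fun Y => lintegral_sumElim_rightMul hp hq Y hf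

theorem nbarMeasure_univ_mul_detMeasure_univ (hp : 1 ≤ p) (hq : 1 ≤ q) :
    nbarMeasure F p q Set.univ * detMeasure F p q Set.univ =
      gaussMat F (Fin p ⊕ Fin q) (Fin p) Set.univ := by
  have h := congrArg (· Set.univ) (map_absDet_gramVol (F := F) hp hq)
  rwa [Measure.map_apply (by fun_prop) .univ, Measure.map_apply (by fun_prop) .univ,
    Set.preimage_univ, Set.preimage_univ, ← Set.univ_prod_univ, Measure.prod_prod, eq_comm] at h

theorem nbarMeasure_univ_ne_zero (hp : 1 ≤ p) (hq : 1 ≤ q) :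
    nbarMeasure F p q Set.univ ≠ 0 :=
  left_ne_zero_of_mul ((nbarMeasure_univ_mul_detMeasure_univ hp hq).trans_ne (NeZero.ne _))

theorem detMeasure_univ_ne_zero (hp : 1 ≤ p) (hq : 1 ≤ q) :
    detMeasure F p q Set.univ ≠ 0 :=
  right_ne_zero_of_mul ((nbarMeasure_univ_mul_detMeasure_univ hp hq).trans_ne (NeZero.ne _))

theorem nbarMeasure_univ_ne_top (hp : 1 ≤ p) (hq : 1 ≤ q) :
    nbarMeasure F p q Set.univ ≠ ∞ :=
  (ENNReal.lt_top_of_mul_ne_top_left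
    ((nbarMeasure_univ_mul_detMeasure_univ hp hq).trans_ne (measure_ne_top _ _))
    (detMeasure_univ_ne_zero hp hq)).ne

theorem detMeasure_univ_ne_top (hp : 1 ≤ p) (hq : 1 ≤ q) :
    detMeasure F p q Set.univ ≠ ∞ :=
  (ENNReal.lt_top_of_mul_ne_top_right
    ((nbarMeasure_univ_mul_detMeasure_univ hp hq).trans_ne (measure_ne_top _ _))
    (nbarMeasure_univ_ne_zero hp hq)).ne

/-- The cosine of the angle between the column space of `Z` and `𝕂^p × 0`. -/
def columnCos (Z : Fin p ⊕ Fin q → Fin p → F) : ℝ :=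
  (absDet fun i => Z (Sum.inl i)) / gramVol Z

@[fun_prop]
theorem measurable_columnCos : Measurable (columnCos : (Fin p ⊕ Fin q → Fin p → F) → ℝ) := by
  unfold columnCos
  fun_prop

theorem map_columnCos (hp : 1 ≤ p) (hq : 1 ≤ q) :
    (gaussMat F (Fin p ⊕ Fin q) (Fin p)).map columnCos =
      detMeasure F p q Set.univ • (nbarMeasure F p q).map fun Y => (nbarVol Y)⁻¹ := by
  have h := congrArg (Measure.map fun x : ℝ × ℝ => x.1 / x.2) (map_absDet_gramVol (F := F) hp hq)
  rw [Measure.map_map (by fun_prop) (by fun_prop), Measure.map_map (by fun_prop) (by fun_prop)] at h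
  have hae : (fun x : (Fin q → Fin p → F) × (Fin p → Fin p → F) =>
      absDet x.2 / nbarVol x.1 / absDet x.2)
      =ᵐ[(nbarMeasure F p q).prod (detMeasure F p q)] fun x => (nbarVol x.1)⁻¹ := by
    filter_upwards [Measure.quasiMeasurePreserving_snd.ae ae_detMeasure_absDet_ne_zero] with x hx
    rw [div_right_comm, div_self hx, one_div]
  rw [← Measure.map_smul, ← Measure.map_fst_prod, Measure.map_map (by fun_prop) measurable_fst]
  exact h.trans (Measure.map_congr hae)

theorem map_absDet_gaussMat (hp : 1 ≤ p) (hq : 1 ≤ q) :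
    gaussMat F (Fin q) (Fin p) Set.univ • (gaussMat F (Fin p) (Fin p)).map absDet =
      ((nbarMeasure F p q).prod (detMeasure F p q)).map
        fun x => (nbarVol x.1)⁻¹ * absDet x.2 := by
  have h := congrArg (Measure.map Prod.fst) (map_absDet_gramVol (F := F) hp hq)
  rw [Measure.map_map (by fun_prop) (by fun_prop), Measure.map_map (by fun_prop) (by fun_prop),
    ← measurePreserving_sumElim_rows.map_eq,
    Measure.map_map (by fun_prop) measurePreserving_sumElim_rows.measurable] at h
  rw [← Measure.map_smul, ← Measure.map_fst_prod, Measure.map_map (by fun_prop) measurable_fst]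
  simp only [inv_mul_eq_div]
  exact h

end Polar

/-! ### The upper left block of a random element of `K` -/

section Average

variable {F : ScalarField} {p q : ℕ}

instance : IsProbabilityMeasure (haarK F p q) :=
  ⟨Measure.haarMeasure_self (K₀ := (⊤ : TopologicalSpace.PositiveCompacts (K F p q)))⟩

instance : (haarK F p q).IsMulLeftInvariant :=
  inferInstanceAs (Measure.haarMeasure ⊤).IsMulLeftInvariant

/-- `α_P(x)`, on the scale of `|det_ℝ|`: the absolute determinant of the upper left block. -/
def blockDet (x : G F p q) : ℝ := absDet x.mat.toBlocks₁₁

@[fun_prop]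
theorem continuous_mat : Continuous fun k : K F p q => (k : G F p q).mat :=
  Units.continuous_val.comp (continuous_subtype_val.comp continuous_subtype_val)

@[fun_prop]
theorem continuous_blockDet : Continuous fun k : K F p q => blockDet (k : G F p q) :=
  continuous_absDet.comp (continuous_mat.matrix_submatrix Sum.inl Sum.inl)

theorem mat_inv_of_mem_K {k : G F p q} (hk : k ∈ K F p q) : k⁻¹.mat = star k.mat :=
  (Units.eq_inv_of_mul_eq_one_right hk).symm

theorem blockDet_inv {k : G F p q} (hk : k ∈ K F p q) : blockDet k⁻¹ = blockDet k := by
  rw [blockDet, mat_inv_of_mem_K hk]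
  exact congrArg abs (realDet_star k.mat.toBlocks₁₁)

theorem columnCos_frame_mul {k : G F p q} (hk : k ∈ K F p q) {W : Matrix (Fin p) (Fin p) F}
    (hW : absDet W ≠ 0) : columnCos (frame k.mat * W) = blockDet k := by
  have htop : (absDet fun i => (frame k.mat * W) (Sum.inl i)) = blockDet k * absDet W :=
    absDet_mul k.mat.toBlocks₁₁ W
  unfold columnCos
  rw [htop, gramVol_frame_mul hk, mul_div_cancel_right₀ _ hW]

theorem columnCos_leftMul_star (k : K F p q) {k₀ : G F p q} (hk₀ : k₀ ∈ K F p q)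
    {W : Matrix (Fin p) (Fin p) F} (hW : absDet W ≠ 0) :
    columnCos (leftMul (star (k : G F p q).mat) (frame k₀.mat * W)) =
      blockDet (k₀⁻¹ * (k : G F p q)) := by
  have hmem : (k : G F p q)⁻¹ * k₀ ∈ K F p q := mul_mem (inv_mem k.2) hk₀
  have hmul : leftMul (star (k : G F p q).mat) (frame k₀.mat * W) =
      frame ((k : G F p q)⁻¹ * k₀).mat * W := by
    rw [G.mat_mul, frame_mul, mat_inv_of_mem_K k.2, Matrix.mul_assoc]
    rfl
  rw [hmul, columnCos_frame_mul hmem hW, ← blockDet_inv hmem, _root_.mul_inv_rev, inv_inv]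

theorem exists_eq_frame_mul (hp : 1 ≤ p) (hq : 1 ≤ q) {Z : Fin p ⊕ Fin q → Fin p → F}
    (hZ : (absDet fun i => Z (Sum.inl i)) ≠ 0) :
    ∃ k ∈ K F p q, ∃ W : Matrix (Fin p) (Fin p) F,
      absDet W ≠ 0 ∧ Z = frame k.mat * W := by
  let Z₁ : Matrix (Fin p) (Fin p) F := fun i => Z (Sum.inl i)
  let Z₂ : Matrix (Fin q) (Fin p) F := fun i => Z (Sum.inr i)
  obtain ⟨u, hu⟩ : IsUnit Z₁ := isUnit_of_realDet_ne_zero (abs_ne_zero.1 hZ)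
  obtain ⟨k, hk, b, hb, hdet⟩ := exists_frame_nbar_eq (Z₂ * u⁻¹.val)
  refine ⟨k, hk, b * Z₁, ?_, ?_⟩
  · rw [absDet_mul, hdet]
    exact mul_ne_zero (nbarVol_pos hp hq _).ne' hZ
  · have hZ₂ : Z₂ * u⁻¹.val * Z₁ = Z₂ := by
      rw [Matrix.mul_assoc, ← hu, Units.inv_mul, Matrix.mul_one]
    rw [← Matrix.mul_assoc, ← hb]
    refine Eq.trans ?_ (frame_nbar_mul (Z₂ * u⁻¹.val) Z₁).symm
    funext i
    rcases i with i | i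
    · rfl
    · exact (congrFun hZ₂ i).symm

theorem lintegral_columnCos_leftMul_star (hp : 1 ≤ p) (hq : 1 ≤ q)
    {Z : Fin p ⊕ Fin q → Fin p → F} (hZ : (absDet fun i => Z (Sum.inl i)) ≠ 0)
    (f : ℝ → ℝ≥0∞) :
    ∫⁻ k : K F p q, f (columnCos (leftMul (star (k : G F p q).mat) Z)) ∂haarK F p q =
      ∫⁻ k : K F p q, f (blockDet (k : G F p q)) ∂haarK F p q := by
  obtain ⟨k₀, hk₀, W, hW, rfl⟩ := exists_eq_frame_mul hp hq hZ
  simp only [columnCos_leftMul_star _ hk₀ hW]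
  exact lintegral_mul_left_eq_self (fun k : K F p q => f (blockDet (k : G F p q))) ⟨k₀, hk₀⟩⁻¹

theorem ae_absDet_inl_ne_zero :
    ∀ᵐ Z ∂gaussMat F (Fin p ⊕ Fin q) (Fin p), (absDet fun i => Z (Sum.inl i)) ≠ 0 := by
  rw [← measurePreserving_sumElim_rows.map_eq]
  refine (ae_map_iff measurePreserving_sumElim_rows.measurable.aemeasurable
    (measurableSet_eq_fun (by fun_prop) measurable_const).compl).2 ?_
  exact Measure.quasiMeasurePreserving_fst.ae (ae_absDet_ne_zero p)

theorem measurable_leftMul_star : Measurable fun x : K F p q × (Fin p ⊕ Fin q → Fin p → F) =>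
    (leftMul (star (x.1 : G F p q).mat) x.2 : Fin p ⊕ Fin q → Fin p → F) := by
  refine measurable_pi_lambda _ fun i => measurable_pi_lambda _ fun j => ?_
  simp only [leftMul_apply, Matrix.mul_apply, Matrix.of_apply, Matrix.star_apply]
  refine Finset.measurable_sum _ fun l _ => ?_
  have hstar : Measurable fun k : K F p q => star ((k : G F p q).mat l i) :=
    (continuous_star.comp ((continuous_apply_apply l i).comp continuous_mat)).measurable
  have hentry : Measurable fun Z : Fin p ⊕ Fin q → Fin p → F => Z l j := by fun_prop
  exact (hstar.comp measurable_fst).mul (hentry.comp measurable_snd)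

theorem map_columnCos_eq_map_blockDet (hp : 1 ≤ p) (hq : 1 ≤ q) :
    (gaussMat F (Fin p ⊕ Fin q) (Fin p)).map columnCos =
      gaussMat F (Fin p ⊕ Fin q) (Fin p) Set.univ •
        (haarK F p q).map fun k : K F p q => blockDet (k : G F p q) := by
  refine Measure.ext_of_lintegral _ fun f hf => ?_
  set γ := gaussMat F (Fin p ⊕ Fin q) (Fin p)
  have hinv (k : K F p q) : ∫⁻ Z, f (columnCos (leftMul (star (k : G F p q).mat) Z)) ∂γ =
      ∫⁻ Z, f (columnCos Z) ∂γ :=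
    (measurePreserving_leftMul (Unitary.star_mem (G.mat_mem_unitary k.2))).lintegral_comp
      (hf.comp measurable_columnCos)
  have hjoint : Measurable fun x : K F p q × (Fin p ⊕ Fin q → Fin p → F) =>
      f (columnCos (leftMul (star (x.1 : G F p q).mat) x.2)) :=
    hf.comp (measurable_columnCos.comp measurable_leftMul_star)
  rw [lintegral_map hf measurable_columnCos, lintegral_smul_measure,
    lintegral_map hf continuous_blockDet.measurable, smul_eq_mul, mul_comm]
  calc ∫⁻ Z, f (columnCos Z) ∂γ
      = ∫⁻ k : K F p q, ∫⁻ Z, f (columnCos (leftMul (star (k : G F p q).mat) Z)) ∂γ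
          ∂haarK F p q := by
        rw [lintegral_congr hinv, lintegral_const, measure_univ, mul_one]
    _ = ∫⁻ Z, ∫⁻ k : K F p q, f (columnCos (leftMul (star (k : G F p q).mat) Z)) ∂haarK F p q
          ∂γ := lintegral_lintegral_swap hjoint.aemeasurable
    _ = ∫⁻ _, ∫⁻ k : K F p q, f (blockDet (k : G F p q)) ∂haarK F p q ∂γ :=
        lintegral_congr_ae <| ae_absDet_inl_ne_zero.mono fun Z hZ =>
          lintegral_columnCos_leftMul_star hp hq hZ f
    _ = _ := lintegral_const _

variable (F p q) in
/-- The measure `a_P(n̄)^{-2ρ} dn̄` on `N̄ ≅ M_{q×p}(𝕂)`, normalized to mass `1`. -/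
def nbarLaw : Measure (Fin q → Fin p → F) :=
  (nbarMeasure F p q Set.univ)⁻¹ • nbarMeasure F p q

theorem map_blockDet (hp : 1 ≤ p) (hq : 1 ≤ q) :
    (haarK F p q).map (fun k : K F p q => blockDet (k : G F p q)) =
      (nbarLaw F p q).map fun Y => (nbarVol Y)⁻¹ := by
  have h := (map_columnCos (F := F) hp hq).symm.trans (map_columnCos_eq_map_blockDet hp hq)
  rw [← nbarMeasure_univ_mul_detMeasure_univ hp hq] at h
  rw [nbarLaw, Measure.map_smul]
  have hdet : (nbarMeasure F p q Set.univ * detMeasure F p q Set.univ)⁻¹ *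
      detMeasure F p q Set.univ = (nbarMeasure F p q Set.univ)⁻¹ := by
    rw [ENNReal.mul_inv (.inl (nbarMeasure_univ_ne_zero hp hq))
      (.inl (nbarMeasure_univ_ne_top hp hq)), mul_assoc,
      ENNReal.inv_mul_cancel (detMeasure_univ_ne_zero hp hq) (detMeasure_univ_ne_top hp hq),
      mul_one]
  rw [← hdet, ← smul_smul, h, smul_smul, ENNReal.inv_mul_cancel
    (mul_ne_zero (nbarMeasure_univ_ne_zero hp hq) (detMeasure_univ_ne_zero hp hq))
    (ENNReal.mul_ne_top (nbarMeasure_univ_ne_top hp hq) (detMeasure_univ_ne_top hp hq)), one_smul]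

end Average

/-! ### The moments of `a_P` and the Gamma quotient -/

section Moments

variable {F : ScalarField} {p q : ℕ}

theorem hasMoment_nbarMeasure (hp : 1 ≤ p) (hq : 1 ≤ q) {s : ℂ} (hs : -1 < s.re) :
    HasMoment (nbarMeasure F p q) (fun Y => (nbarVol Y)⁻¹) s
      ((gaussMat F (Fin q) (Fin p)).real Set.univ * (detGamma F p s / detGamma F p (s + q))) := by
  obtain ⟨C, hC, hgauss⟩ := exists_gaussMat_moment_eq (F := F) p
  have hC' : (C : ℂ) ≠ 0 := Complex.ofReal_ne_zero.2 hC
  have hsq : -1 < (s + q).re := by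
    rw [Complex.add_re, Complex.natCast_re]
    linarith [q.cast_nonneg (α := ℝ)]
  have hdet : HasMoment (detMeasure F p q) absDet s (C * detGamma F p (s + q)) :=
    (hasMoment_withDensity_pow_iff (by fun_prop)
      ((ae_absDet_ne_zero p).mono fun W hW => (absDet_nonneg W).lt_of_ne' hW) q).2 (hgauss _ hsq)
  have hprod := ((hasMoment_map_iff (f := id) (φ := absDet) (by fun_prop) measurable_id).2
    (hgauss s hs)).smul_measure (measure_ne_top (gaussMat F (Fin q) (Fin p)) Set.univ)
  rw [map_absDet_gaussMat hp hq, hasMoment_map_iff (by fun_prop) measurable_id] at hprod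
  convert hprod.of_mul_prod hdet (mul_ne_zero hC' (detGamma_ne_zero p hsq))
    (fun Y => inv_nonneg.2 (nbarVol_pos hp hq Y).le) absDet_nonneg using 1
  rw [measureReal_def, mul_div_assoc, mul_div_mul_left _ _ hC']

theorem hasMoment_nbarLaw (hp : 1 ≤ p) (hq : 1 ≤ q) {s : ℂ} (hs : -1 < s.re) :
    HasMoment (nbarLaw F p q) (fun Y => (nbarVol Y)⁻¹) s
      (detGamma F p q / detGamma F p 0 * (detGamma F p s / detGamma F p (s + q))) := by
  have hγ : ((gaussMat F (Fin q) (Fin p)).real Set.univ : ℂ) ≠ 0 := Complex.ofReal_ne_zero.2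
    (ENNReal.toReal_pos (NeZero.ne _) (measure_ne_top _ _)).ne'
  have hmass := (hasMoment_nbarMeasure (F := F) hp hq (s := 0) (by simp)).measureReal_univ
  rw [zero_add] at hmass
  have hmom := (hasMoment_nbarMeasure (F := F) hp hq hs).smul_measure
    (ENNReal.inv_ne_top.2 (nbarMeasure_univ_ne_zero (F := F) hp hq))
  rw [ENNReal.toReal_inv, ← measureReal_def, Complex.ofReal_inv, hmass, mul_inv, mul_mul_mul_comm,
    inv_mul_cancel₀ hγ, one_mul, inv_div] at hmom
  exact hmom

theorem hasMoment_blockDet_iff (hp : 1 ≤ p) (hq : 1 ≤ q) {s a : ℂ} :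
    HasMoment (haarK F p q) (fun k => blockDet (k : G F p q)) s a ↔
      HasMoment (nbarLaw F p q) (fun Y => (nbarVol Y)⁻¹) s a := by
  have h := hasMoment_map_iff (f := id) (s := s) (a := a) (ν := haarK F p q)
    continuous_blockDet.measurable measurable_id
  rw [map_blockDet hp hq, hasMoment_map_iff (by fun_prop) measurable_id] at h
  exact h.symm

variable (F p q) in
theorem two_mul_rho_div_d : (2 * (rho F p q : ℂ)) / F.d = ((p + q : ℕ) : ℂ) := by
  have hd : (F.d : ℂ) ≠ 0 := Nat.cast_ne_zero.2 (d_pos F).ne'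
  rw [rho]
  push_cast
  field_simp

theorem iwasawaPow_nbar_eq_cpow (hp : 1 ≤ p) (hq : 1 ≤ q) (Y : Fin q → Fin p → F) (z : ℂ) :
    iwasawaPow (nbar (Matrix.of Y)) (-z) = (((nbarVol Y)⁻¹ : ℝ) : ℂ) ^ (z / F.d) := by
  have harg : (nbarVol Y : ℂ).arg ≠ Real.pi := by
    rw [Complex.arg_ofReal_of_nonneg (nbarVol_pos hp hq Y).le]
    exact Real.pi_pos.ne
  rw [iwasawaPow_eq_cpow hp hq, neg_div, Complex.cpow_neg, Complex.ofReal_inv,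
    Complex.inv_cpow _ _ harg, nbarVol]

theorem haarNbar_eq (hp : 1 ≤ p) (hq : 1 ≤ q) :
    haarNbar F p q = (nbarMeasure F p q Set.univ)⁻¹ • volume := by
  have hdensity (Y : Fin q → Fin p → F) : ‖iwasawaPow (nbar (Matrix.of Y)) (-(2 * rho F p q))‖ₑ =
      ENNReal.ofReal (nbarVol Y ^ (p + q))⁻¹ := by
    rw [iwasawaPow_nbar_eq_cpow hp hq, two_mul_rho_div_d, Complex.cpow_natCast,
      ← Complex.ofReal_pow, ← ofReal_norm, Complex.norm_real, inv_pow,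
      Real.norm_of_nonneg (inv_nonneg.2 (pow_nonneg (nbarVol_pos hp hq Y).le _))]
  set c := Measure.addHaarScalarFactor (Measure.addHaar : Measure (Fin q → Fin p → F)) volume
  have hc : (c : ℝ≥0∞) ≠ 0 := ENNReal.coe_ne_zero.2
    (Measure.addHaarScalarFactor_pos_of_isAddHaarMeasure _ _).ne'
  have hhaar : (Measure.addHaar : Measure (Fin q → Fin p → F)) = (c : ℝ≥0∞) • volume :=
    Measure.isAddLeftInvariant_eq_smul _ _
  rw [haarNbar, lintegral_congr hdensity, hhaar, lintegral_smul_measure, smul_smul, smul_eq_mul,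
    ENNReal.mul_inv (.inl hc) (.inl ENNReal.coe_ne_top), mul_right_comm,
    ENNReal.inv_mul_cancel hc ENNReal.coe_ne_top, one_mul, nbarMeasure,
    withDensity_apply _ .univ, setLIntegral_univ]

theorem nbarLaw_eq_withDensity_haarNbar (hp : 1 ≤ p) (hq : 1 ≤ q) :
    nbarLaw F p q =
      (haarNbar F p q).withDensity fun Y => ENNReal.ofReal ((nbarVol Y)⁻¹ ^ (p + q)) := by
  simp only [haarNbar_eq hp hq, withDensity_smul_measure, inv_pow, nbarLaw, nbarMeasure]

theorem gammaQuotient_eq_detGamma (lam : ℂ) :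
    gammaQuotient F p q lam = detGamma F p q / detGamma F p 0 *
      (detGamma F p ((lam - rho F p q) / F.d) / detGamma F p ((lam - rho F p q) / F.d + q)) := by
  have hd : (F.d : ℂ) ≠ 0 := Nat.cast_ne_zero.2 (d_pos F).ne'
  have hnum : (F.d : ℂ) * (p + (lam - rho F p q) / F.d) = lam - rho F p q + F.d * p := by
    field_simp
    ring
  have hden : (F.d : ℂ) * (p + ((lam - rho F p q) / F.d + q)) = lam + rho F p q := by
    rw [rho]
    push_cast
    field_simp
    ring
  rw [gammaQuotient, detGamma, detGamma, detGamma, detGamma, hnum, hden, add_zero]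

theorem hasMoment_nbarLaw_gammaQuotient (hp : 1 ≤ p) (hq : 1 ≤ q) {lam : ℂ}
    (hlam : rho F p q - F.d < lam.re) :
    HasMoment (nbarLaw F p q) (fun Y => (nbarVol Y)⁻¹) ((lam - rho F p q) / F.d)
      (gammaQuotient F p q lam) := by
  rw [gammaQuotient_eq_detGamma]
  refine hasMoment_nbarLaw hp hq ?_
  have hd : (0 : ℝ) < F.d := Nat.cast_pos.2 (d_pos F)
  rw [← Complex.ofReal_natCast, Complex.div_ofReal_re, Complex.sub_re, Complex.ofReal_re,
    lt_div_iff₀ hd]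
  linarith

theorem hasMoment_haarNbar (hp : 1 ≤ p) (hq : 1 ≤ q) {lam : ℂ}
    (hlam : rho F p q - F.d < lam.re) :
    HasMoment (haarNbar F p q) (fun Y => (nbarVol Y)⁻¹) ((lam + rho F p q) / F.d)
      (gammaQuotient F p q lam) := by
  have h := hasMoment_nbarLaw_gammaQuotient hp hq hlam
  rw [nbarLaw_eq_withDensity_haarNbar hp hq, hasMoment_withDensity_pow_iff (by fun_prop)
    (.of_forall fun Y => inv_pos.2 (nbarVol_pos hp hq Y)), ← two_mul_rho_div_d, ← add_div] at h
  convert h using 2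
  ring

theorem integrable_iwasawaPow_nbar (hp : 1 ≤ p) (hq : 1 ≤ q) {lam : ℂ}
    (hlam : rho F p q - F.d < lam.re) :
    Integrable (fun Y : Fin q → Fin p → F =>
      iwasawaPow (nbar (Matrix.of Y)) (-lam - rho F p q)) (haarNbar F p q) := by
  simp only [← neg_add', iwasawaPow_nbar_eq_cpow hp hq]
  exact (hasMoment_haarNbar hp hq hlam).1

theorem integral_iwasawaPow_nbar (hp : 1 ≤ p) (hq : 1 ≤ q) {lam : ℂ}
    (hlam : rho F p q - F.d < lam.re) :
    ∫ Y : Fin q → Fin p → F, iwasawaPow (nbar (Matrix.of Y)) (-lam - rho F p q) ∂haarNbar F p q =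
      gammaQuotient F p q lam := by
  simp only [← neg_add', iwasawaPow_nbar_eq_cpow hp hq]
  exact (hasMoment_haarNbar hp hq hlam).2

theorem ae_blockDet_ne_zero (hp : 1 ≤ p) (hq : 1 ≤ q) :
    ∀ᵐ k : K F p q ∂haarK F p q, blockDet (k : G F p q) ≠ 0 := by
  refine ae_of_ae_map (p := (· ≠ 0)) continuous_blockDet.measurable.aemeasurable ?_
  rw [map_blockDet hp hq]
  refine (ae_map_iff (by fun_prop) (measurableSet_singleton 0).compl).2 (.of_forall fun Y => ?_)
  exact inv_ne_zero (nbarVol_pos hp hq Y).ne'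

theorem alphaPow_ae_eq_cpow (hp : 1 ≤ p) (hq : 1 ≤ q) (z : ℂ) :
    (fun k : K F p q => alphaPow (k : G F p q) z) =ᵐ[haarK F p q]
      fun k => (blockDet (k : G F p q) : ℂ) ^ (z / F.d) :=
  (ae_blockDet_ne_zero hp hq).mono fun _ hk => alphaPow_eq_cpow hp hq hk z

theorem integrable_alphaPow (hp : 1 ≤ p) (hq : 1 ≤ q) {lam : ℂ}
    (hlam : rho F p q - F.d < lam.re) :
    Integrable (fun k : K F p q => alphaPow (k : G F p q) (lam - rho F p q)) (haarK F p q) :=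
  ((hasMoment_blockDet_iff hp hq).2 (hasMoment_nbarLaw_gammaQuotient hp hq hlam)).1.congr
    (alphaPow_ae_eq_cpow hp hq _).symm

theorem cP_eq_gammaQuotient (hp : 1 ≤ p) (hq : 1 ≤ q) {lam : ℂ}
    (hlam : rho F p q - F.d < lam.re) : cP F p q lam = gammaQuotient F p q lam :=
  (integral_congr_ae (alphaPow_ae_eq_cpow hp hq _)).trans
    ((hasMoment_blockDet_iff hp hq).2 (hasMoment_nbarLaw_gammaQuotient hp hq hlam)).2

theorem J_const (hp : 1 ≤ p) (hq : 1 ≤ q) {lam : ℂ} (hlam : rho F p q - F.d < lam.re)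
    (w : ℂ) (k : K F p q) : J F p q lam (fun _ => w) k = cP F p q lam * w := by
  rw [J, integral_mul_const, integral_iwasawaPow_nbar hp hq hlam, cP_eq_gammaQuotient hp hq hlam]

end Moments

/-! ### Meromorphic continuation -/

section Continuation

open scoped Topology

theorem meromorphic_siegelGamma (p d : ℕ) (a : ℂ) :
    Meromorphic fun lam : ℂ => siegelGamma p d fun _ => (lam + a) / 2 := fun x =>
  MeromorphicAt.fun_prod fun j _ => (Meromorphic.Gamma _).comp_analyticAt
    (g := fun lam => (lam + a) / 2 - (d : ℂ) / 2 * (j : ℕ)) (by fun_prop)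

theorem meromorphic_gammaQuotient (F : ScalarField) (p q : ℕ) :
    Meromorphic (gammaQuotient F p q) := fun x => by
  have hnum := meromorphic_siegelGamma p F.d (-rho F p q + F.d * p) x
  have hden := meromorphic_siegelGamma p F.d (rho F p q) x
  simp only [← add_assoc, ← sub_eq_add_neg] at hnum
  exact (MeromorphicAt.const _ x).mul (hnum.div hden)

theorem eventuallyEq_codiscrete_of_eventuallyEq_nhdsNE {𝕜 E : Type*} [RCLike 𝕜]
    [NormedAddCommGroup E] [NormedSpace 𝕜 E] {f g : 𝕜 → E} (hf : Meromorphic f)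
    (hg : Meromorphic g) {x : 𝕜} (hfg : f =ᶠ[𝓝[≠] x] g) : f =ᶠ[Filter.codiscrete 𝕜] g := by
  have hsub : Meromorphic (f - g) := fun y => (hf y).sub (hg y)
  have hx : meromorphicOrderAt (f - g) x = ⊤ :=
    meromorphicOrderAt_eq_top_iff.2 (hfg.mono fun y hy => sub_eq_zero.2 hy)
  have hall (y : 𝕜) : meromorphicOrderAt (f - g) y = ⊤ := by
    by_contra hy
    exact hsub.exists_meromorphicOrderAt_ne_top_iff_forall.1 ⟨y, hy⟩ x hx
  rw [Filter.EventuallyEq, Filter.Eventually, Filter.codiscrete,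
    mem_codiscreteWithin_iff_forall_mem_nhdsNE]
  intro y _
  filter_upwards [meromorphicOrderAt_eq_top_iff.1 (hall y)] with z hz
  exact Or.inl (sub_eq_zero.1 hz)

theorem eventuallyEq_codiscrete_of_eqOn_halfPlane {f g : ℂ → ℂ} (hf : Meromorphic f)
    (hg : Meromorphic g) {R : ℝ} (h : ∀ z : ℂ, R < z.re → f z = g z) :
    f =ᶠ[Filter.codiscrete ℂ] g := by
  have hopen : IsOpen {z : ℂ | R < z.re} := isOpen_lt continuous_const Complex.continuous_re
  have hmem : ((R + 1 : ℝ) : ℂ) ∈ {z : ℂ | R < z.re} := by simp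
  exact eventuallyEq_codiscrete_of_eventuallyEq_nhdsNE hf hg <| mem_nhdsWithin_of_mem_nhds <|
    Filter.mem_of_superset (hopen.mem_nhds hmem) h

end Continuation

end CosLambda
end

theorem mainTheorem5_general (F : CosLambda.ScalarField) (p q : ℕ) (hp : 1 ≤ p) (hq : 1 ≤ q) :
    (∀ lam : ℂ, CosLambda.rho F p q - F.d < lam.re →
      MeasureTheory.Integrable
        (fun k : CosLambda.K F p q =>
          CosLambda.alphaPow (k : CosLambda.G F p q) (lam - CosLambda.rho F p q))
        (CosLambda.haarK F p q) ∧
      CosLambda.cP F p q lam = CosLambda.gammaQuotient F p q lam ∧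
      MeasureTheory.Integrable
        (fun Y : Fin q → Fin p → F =>
          CosLambda.iwasawaPow (CosLambda.nbar (Matrix.of Y)) (-lam - CosLambda.rho F p q))
        (CosLambda.haarNbar F p q) ∧
      ∀ (w : ℂ) (k : CosLambda.K F p q),
        CosLambda.J F p q lam (fun _ => w) k = CosLambda.cP F p q lam * w) ∧
    Meromorphic (CosLambda.gammaQuotient F p q) ∧
    ∀ c : ℂ → ℂ, Meromorphic c →
      (∃ R : ℝ, ∀ lam : ℂ, R < lam.re → c lam = CosLambda.cP F p q lam) →
      c =ᶠ[Filter.codiscrete ℂ] CosLambda.gammaQuotient F p q := by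
  refine ⟨fun lam hlam => ⟨CosLambda.integrable_alphaPow hp hq hlam,
    CosLambda.cP_eq_gammaQuotient hp hq hlam, CosLambda.integrable_iwasawaPow_nbar hp hq hlam,
    CosLambda.J_const hp hq hlam⟩, CosLambda.meromorphic_gammaQuotient F p q, ?_⟩
  rintro c hc ⟨R, hR⟩
  refine CosLambda.eventuallyEq_codiscrete_of_eqOn_halfPlane hc
    (CosLambda.meromorphic_gammaQuotient F p q)
    (R := max R (CosLambda.rho F p q - F.d)) fun lam hlam => ?_
  rw [hR lam ((le_max_left _ _).trans_lt hlam),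
    CosLambda.cP_eq_gammaQuotient hp hq ((le_max_right _ _).trans_lt hlam)]

theorem mainTheorem5 (F : CosLambda.ScalarField) (p q : ℕ) (hp : 1 ≤ p) (hpq : p ≤ q) :
    -- the integrals converge for `Re λ > ρ - d` and have the stated value
    (∀ lam : ℂ, CosLambda.rho F p q - F.d < lam.re →
      MeasureTheory.Integrable
        (fun k : CosLambda.K F p q =>
          CosLambda.alphaPow (k : CosLambda.G F p q) (lam - CosLambda.rho F p q))
        (CosLambda.haarK F p q) ∧
      CosLambda.cP F p q lam = CosLambda.gammaQuotient F p q lam ∧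
      MeasureTheory.Integrable
        (fun Y : Fin q → Fin p → F =>
          CosLambda.iwasawaPow (CosLambda.nbar (Matrix.of Y)) (-lam - CosLambda.rho F p q))
        (CosLambda.haarNbar F p q) ∧
      ∀ (w : ℂ) (k : CosLambda.K F p q),
        CosLambda.J F p q lam (fun _ => w) k = CosLambda.cP F p q lam * w) ∧
    -- the right-hand side is meromorphic, and it is the meromorphic continuation of `c_P`
    Meromorphic (CosLambda.gammaQuotient F p q) ∧
    ∀ c : ℂ → ℂ, Meromorphic c →
      (∃ R : ℝ, ∀ lam : ℂ, R < lam.re → c lam = CosLambda.cP F p q lam) →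
      c =ᶠ[Filter.codiscrete ℂ] CosLambda.gammaQuotient F p q :=
  mainTheorem5_general F p q hp (hp.trans hpq)
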